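/- Let $\sigma\in L^2(\phi)$, $\phi=\mathcal N(0,1)$, with $\mathbb E_{g\sim\phi}[\sigma(g)^2]=1$, and let $a_k=\mathbb E_{g\sim\phi}[\sigma(g)h_k(g)]$, where $h_k=He_k/\sqrt{k!}$ are the normalized probabilists' Hermite polynomials. Put $G_\sigma(s)=\sum_{k\ge 0}a_k^2s^k$ and, for $L\ge 0$ and $\rho\in[-1,1]$, $K_\sigma^{(L)}(\rho)=(G_\sigma\circ\cdots\circ G_\sigma)(\rho)$ ($L$ factors). Let $(Z_{\sigma,L})_{L\ge 0}$ be the Galton–Watson branching process with $Z_{\sigma,0}=1$ and offspring distribution $\mathbf P(Y_\sigma=k)=a_k^2$, $k\ge 0$. Let $d\ge 2$, let $\tau_{d-1}$ be the uniform probability measure on the unit sphere $\mathbb S^{d-1}\subset\mathbb R^d$, and let $S_{n-1}$ denote the surface area of the unit sphere of $\mathbb R^n$ (so $S_0=2$). For each $k\ge 0$ let $\mathbb Y_k^d$ be the space of spherical harmonics of degree $k$ (the restrictions to $\mathbb S^{d-1}$ of the real harmonic homogeneous polynomials of degree $k$ on $\mathbb R^d$), let $N_{k,d}=\dim\mathbb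 Y_k^d$, and let $\{Y_{k,j}\}_{1\le j\le N_{k,d}}$ be any basis of $\mathbb Y_k^d$ that is orthonormal in $L^2(\tau_{d-1})$. Then for every depth $L\ge 0$ and all $x,z\in\mathbb S^{d-1}$, $$K_\sigma^{(L)}(\langle x,z\rangle)=\sum_{k=0}^\infty\lambda_k\sum_{j=1}^{N_{k,d}}Y_{k,j}(x)Y_{k,j}(z),$$ where $$\lambda_k=\frac{S_{d-2}}{S_{d-1}}\,\Gamma\!\left(\tfrac{d-1}{2}\right)\sum_{\ell\ge 0}\mathbf P(Z_{\sigma,L}=k+\ell)\,\frac{(k+\ell)!}{\ell!}\,\frac{1+(-1)^\ell}{2^{k+1}}\,\frac{\Gamma\!\left(\frac{\ell+1}{2}\right)}{\Gamma\!\left(k+\frac{\ell+d}{2}\right)},$$ and both series converge. The functions $\{Y_{k,j}\}_{k\ge 0,\,1\le j\le N_{k,d}}$ form an orthonormal basis of $L^2(\tau_{d-1})$. The integral operator $(\mathcal T_\sigma^{(L)}f)(x)=\int K_\sigma^{(L)}(\langle x,z\rangle)f(z)\,d\tau_{d-1}(z)$ is well defined from $L^2(\tau_{d-1})$ to itself,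 and $\mathcal T_\sigma^{(L)}Y_{k,j}=\lambda_kY_{k,j}$ for all $k,j$. -/

import Mathlib

open MeasureTheory ProbabilityTheory

noncomputable section

/-- The normalized probabilists' Hermite polynomial `h_k = He_k / √(k!)`. -/
def normHermite (k : ℕ) (x : ℝ) : ℝ :=
  Polynomial.aeval x (Polynomial.hermite k) / Real.sqrt (k.factorial : ℝ)

/-- The Hermite coefficient `a_k = 𝔼[σ(g) h_k(g)]`, `g ∼ N(0,1)`. -/
def hermiteCoeff (σ : ℝ → ℝ) (k : ℕ) : ℝ :=
  ∫ x, σ x * normHermite k x ∂(gaussianReal 0 1)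

/-- `σ` is square integrable under the standard Gaussian measure, with `𝔼[σ(g)²] = 1`. -/
structure IsNormalizedActivation (σ : ℝ → ℝ) : Prop where
  memLp : MemLp σ 2 (gaussianReal 0 1)
  integral_sq : ∫ x, σ x ^ 2 ∂(gaussianReal 0 1) = 1

/-- The dual generating function `G_σ(s) = ∑ₖ aₖ² sᵏ`. -/
def dualGenFun (σ : ℝ → ℝ) (s : ℝ) : ℝ :=
  ∑' k : ℕ, hermiteCoeff σ k ^ 2 * s ^ k

/-- The compositional kernel `K_σ^{(L)}(ρ) = (G_σ ∘ ⋯ ∘ G_σ)(ρ)`, with `L` factors. -/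
def compKernel (σ : ℝ → ℝ) (L : ℕ) (ρ : ℝ) : ℝ :=
  (dualGenFun σ)^[L] ρ

/-- `Z` is a Galton–Watson branching process with offspring distribution `(p k)`, started from
one individual: `Y l i` is the number of children of the `i`-th individual of generation `l`. -/
def IsGaltonWatson {Ω : Type*} [MeasurableSpace Ω] (P : Measure Ω) (p : ℕ → ℝ)
    (Z : ℕ → Ω → ℕ) : Prop :=
  ∃ Y : ℕ → ℕ → Ω → ℕ,
    (∀ l i, Measurable (Y l i)) ∧
    iIndepFun (fun q : ℕ × ℕ => Y q.1 q.2) P ∧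
    (∀ l i k, P.real {ω | Y l i ω = k} = p k) ∧
    (∀ ω, Z 0 ω = 1) ∧
    (∀ l ω, Z (l + 1) ω = ∑ i ∈ Finset.range (Z l ω), Y l i ω)

/-- The unit sphere of `ℝᵈ`. -/
abbrev UnitSphere (d : ℕ) : Type :=
  Metric.sphere (0 : EuclideanSpace ℝ (Fin d)) 1

/-- The surface measure of the unit sphere of `ℝᵈ`. -/
def surfaceMeasure (d : ℕ) : Measure (UnitSphere d) :=
  (volume : Measure (EuclideanSpace ℝ (Fin d))).toSphere

/-- The surface area of the unit sphere of `ℝᵈ` (so `S_{d-1}` is `sphereArea d`). -/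
def sphereArea (d : ℕ) : ℝ := (surfaceMeasure d).real Set.univ

/-- The uniform probability measure `τ_{d-1}` on the unit sphere of `ℝᵈ`. -/
def sphereUniform (d : ℕ) : Measure (UnitSphere d) :=
  (surfaceMeasure d Set.univ)⁻¹ • surfaceMeasure d

/-- Restriction of polynomials in `d` variables to the unit sphere. -/
def restrictToSphere (d : ℕ) : MvPolynomial (Fin d) ℝ →ₗ[ℝ] (UnitSphere d → ℝ) where
  toFun q := fun x => MvPolynomial.eval (fun i => (x : EuclideanSpace ℝ (Fin d)) i) q
  map_add' q r := by ext x; simp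
  map_smul' c q := by ext x; simp [MvPolynomial.smul_eval]

/-- The Laplacian `∑ᵢ ∂²/∂xᵢ²` on polynomials. -/
def polyLaplacian (d : ℕ) : MvPolynomial (Fin d) ℝ →ₗ[ℝ] MvPolynomial (Fin d) ℝ :=
  ∑ i : Fin d, (MvPolynomial.pderiv i).toLinearMap ∘ₗ (MvPolynomial.pderiv i).toLinearMap

/-- The space of spherical harmonics of degree `k` in dimension `d`: restrictions to the unit
sphere of the harmonic homogeneous polynomials of degree `k`. -/
def sphericalHarmonics (d k : ℕ) : Submodule ℝ (UnitSphere d → ℝ) :=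
  (MvPolynomial.homogeneousSubmodule (Fin d) ℝ k ⊓ LinearMap.ker (polyLaplacian d)).map
    (restrictToSphere d)

/-- `N_{k,d}`, the dimension of the space of spherical harmonics of degree `k`. -/
def harmonicDim (d k : ℕ) : ℕ := Module.finrank ℝ (sphericalHarmonics d k)

/-- `Y 0, …, Y (N_{k,d} - 1)` is an orthonormal basis of the space of spherical harmonics of
degree `k`, for the `L²` inner product of the uniform probability measure. -/
structure IsHarmonicONB (d k : ℕ) (Y : Fin (harmonicDim d k) → UnitSphere d → ℝ) : Prop where
  span_eq : Submodule.span ℝ (Set.range Y) = sphericalHarmonics d k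
  orthonormal : ∀ i j, ∫ x, Y i x * Y j x ∂(sphereUniform d) = if i = j then 1 else 0

/-- The integral operator on the sphere with kernel `K_σ^{(L)}(⟨x, z⟩)`. -/
def kernelOperator (d : ℕ) (σ : ℝ → ℝ) (L : ℕ) (f : UnitSphere d → ℝ) (x : UnitSphere d) : ℝ :=
  ∫ z, compKernel σ L (inner ℝ (x : EuclideanSpace ℝ (Fin d)) z) * f z ∂(sphereUniform d)

end

/-! Conditioning on one generation at a time gives `E[s ^ Z_L] = (G ∘ ⋯ ∘ G)(s)` for `|s| ≤ 1`
(`IsGaltonWatson.hasSum_iterate`). The kernel is thus `∑ pₙ ρⁿ` with `pₙ = P(Z_L = n)` nonnegative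
and summable, and the problem reduces to the kernels `⟨x, z⟩ⁿ`.

These are diagonalised by the Funk–Hecke formula: integrating `⟨x, z⟩ⁿ` against a harmonic `f` of
degree `k` gives `powEigenvalue d n k * f x` (`integral_inner_pow_mul`). Its proof passes from the
sphere to Gaussian space. In polar coordinates, the Gaussian integral of a homogeneous polynomial is
its sphere integral times an explicit Gamma factor (`polyGaussIntegral_eq_mul_gaussRadial`). On the
Gaussian side, integration by parts removes the factors `⟨a, ·⟩` of the power one after another,
with the same recurrence as `E[gⁿ Heₖ(g)]` (`polyGaussIntegral_linForm_pow_mul`). Integration by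
parts also makes harmonics of different degrees orthogonal.

Every homogeneous polynomial is a combination of products `|x|^{2j} h` with `h` harmonic
(`mem_harmonicSpan`), so on the sphere it is a finite sum of harmonics. This expands `⟨x, z⟩ⁿ` in
the `Y k j` and, with Stone–Weierstrass, yields the Hilbert basis.

The sums over `n` and `k` may be exchanged because on the diagonal `x = z` all terms are nonnegative
with total `∑ pₙ`, and the diagonal dominates the rest (`hasSum_zonal`). Hence `λₖ = ∑ₙ pₙ
powEigenvalue d n k`. Only `n = k + ℓ` contributes, and `powEigenvalue_add` supplies the Gamma
quotients. -/

noncomputable section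

/-! ### Generating functions of Galton–Watson processes -/

section GaltonWatson

variable {Ω : Type*}

/-- The sharp σ-algebra matters: it makes generation `l` independent of the offspring counts `Y l
i`. -/
theorem measurable_generation_of_past {Z : ℕ → Ω → ℕ} {Y : ℕ → ℕ → Ω → ℕ}
    (h0 : ∀ ω, Z 0 ω = 1)
    (hZ : ∀ l ω, Z (l + 1) ω = ∑ i ∈ Finset.range (Z l ω), Y l i ω) (l : ℕ) :
    Measurable[⨆ q ∈ {q : ℕ × ℕ | q.1 < l}, MeasurableSpace.comap (Y q.1 q.2) ⊤] (Z l) := by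
  induction l with
  | zero =>
    have : Z 0 = fun _ => 1 := funext h0
    rw [this]
    exact measurable_const
  | succ l ih =>
    set m := ⨆ q ∈ {q : ℕ × ℕ | q.1 < l + 1}, MeasurableSpace.comap (Y q.1 q.2) ⊤ with hm
    have hZl : Measurable[m] (Z l) := ih.mono
      (biSup_mono fun q (hq : q.1 < l) => Nat.lt_succ_of_lt hq) le_rfl
    have hY : ∀ i, Measurable[m] (Y l i) := fun i => by
      have : MeasurableSpace.comap (Y l i) ⊤ ≤ m :=
        le_biSup (fun q : ℕ × ℕ => MeasurableSpace.comap (Y q.1 q.2) ⊤)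
          (show ((l, i) : ℕ × ℕ) ∈ {q : ℕ × ℕ | q.1 < l + 1} from Nat.lt_succ_self l)
      exact (comap_measurable (Y l i)).mono this le_rfl
    have : Z (l + 1) = fun ω => (fun n ω => ∑ i ∈ Finset.range n, Y l i ω) (Z l ω) ω :=
      funext (hZ l)
    rw [this]
    let _ := m
    -- The number of summands is random but takes countably many values, so it can be frozen at each
    -- `n`.
    refine measurable_from_prod_countable_right (f := fun q : ℕ × Ω =>
      ∑ i ∈ Finset.range q.1, Y l i q.2) (fun n => ?_) |>.comp (hZl.prodMk measurable_id)
    exact Finset.measurable_sum (Finset.range n) fun i _ => hY i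

variable [MeasurableSpace Ω] {P : Measure Ω}

theorem hasSum_measureReal_fiber_mul_pow [IsProbabilityMeasure P] {X : Ω → ℕ} (hX : Measurable X) {s : ℝ} (hs : |s| ≤ 1) :
    HasSum (fun n => P.real {ω | X ω = n} * s ^ n) (∫ ω, s ^ X ω ∂P) := by
  have h := hasSum_integral_iUnion (μ := P) (f := fun ω => s ^ X ω) (s := fun n : ℕ => {ω | X ω = n})
    (fun n => hX (measurableSet_singleton n))
    (fun i j hij => Set.disjoint_left.2 fun ω h1 h2 => hij (h1.symm.trans h2))
    (Integrable.integrableOn (Integrable.of_bound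
      ((measurable_from_nat (f := fun n => s ^ n)).comp hX).aestronglyMeasurable 1
      (ae_of_all _ fun ω => by
        simpa [abs_pow] using pow_le_one₀ (abs_nonneg s) hs)))
  have hU : (⋃ n : ℕ, {ω | X ω = n}) = Set.univ := by ext; simp
  rw [hU, setIntegral_univ] at h
  refine (funext fun n => ?_ : (fun n => P.real {ω | X ω = n} * s ^ n) =
    fun n => ∫ ω in {ω | X ω = n}, s ^ X ω ∂P) ▸ h
  have hn : MeasurableSet {ω | X ω = n} := hX (measurableSet_singleton n)
  rw [setIntegral_congr_fun (g := fun _ => s ^ n) hn]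
  · simp
  · intro ω hω
    have : X ω = n := hω
    simp [this]

theorem abs_integral_pow_le_one [IsProbabilityMeasure P] {X : Ω → ℕ} {s : ℝ} (hs : |s| ≤ 1) :
    |∫ ω, s ^ X ω ∂P| ≤ 1 := by
  have := norm_integral_le_of_norm_le_const (μ := P) (f := fun ω => s ^ X ω) (C := 1)
    (ae_of_all _ fun ω => by simpa [abs_pow] using pow_le_one₀ (abs_nonneg s) hs)
  simpa using this

variable {p : ℕ → ℝ} {Z : ℕ → Ω → ℕ}

theorem IsGaltonWatson.measurable (hGW : IsGaltonWatson P p Z) (l : ℕ) : Measurable (Z l) := by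
  obtain ⟨Y, hYm, -, -, h0, hZ⟩ := hGW
  exact (measurable_generation_of_past h0 hZ l).mono (iSup₂_le fun q _ => (hYm q.1 q.2).comap_le) le_rfl

/-- On the event `Z l = n`, `s ^ Z (l + 1)` is a product of `n` independent factors of mean `G(s)`,
and these are independent of the event. -/
theorem IsGaltonWatson.integral_pow_succ [IsProbabilityMeasure P] (hGW : IsGaltonWatson P p Z) (l : ℕ) {s : ℝ}
    (hs : |s| ≤ 1) :
    ∫ ω, s ^ Z (l + 1) ω ∂P = ∫ ω, (∑' k, p k * s ^ k) ^ Z l ω ∂P := by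
  have hGW' := hGW
  obtain ⟨Y, hYm, hind, hp, h0, hZ⟩ := hGW'
  have hG : ∀ i, ∫ ω, s ^ Y l i ω ∂P = ∑' k, p k * s ^ k := fun i => by
    rw [← (hasSum_measureReal_fiber_mul_pow (P := P) (hYm l i) hs).tsum_eq]
    simp [hp]
  -- `G(s)` is itself an expectation of a power of `s`, so it stays in `[-1, 1]` and may serve as
  -- the argument of the next generating function.
  have hGle : |∑' k, p k * s ^ k| ≤ 1 := hG 0 ▸ abs_integral_pow_le_one hs
  have hZm := fun l => hGW.measurable l
  rw [← (hasSum_measureReal_fiber_mul_pow (hZm l) hGle).tsum_eq]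
  have hmeas : Measurable fun ω => s ^ Z (l + 1) ω :=
    (measurable_from_nat (f := fun n => s ^ n)).comp (hZm (l + 1))
  have h := hasSum_integral_iUnion (μ := P) (f := fun ω => s ^ Z (l + 1) ω)
    (s := fun n : ℕ => {ω | Z l ω = n})
    (fun n => hZm l (measurableSet_singleton n))
    (fun i j hij => Set.disjoint_left.2 fun ω h1 h2 => hij (h1.symm.trans h2))
    (Integrable.integrableOn (Integrable.of_bound hmeas.aestronglyMeasurable 1
      (ae_of_all _ fun ω => by
        simpa [abs_pow] using pow_le_one₀ (abs_nonneg s) hs)))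
  have hU : (⋃ n : ℕ, {ω | Z l ω = n}) = Set.univ := by ext; simp
  rw [hU, setIntegral_univ] at h
  rw [← h.tsum_eq]
  refine tsum_congr fun n => ?_
  have hindep := indep_iSup_of_disjoint (fun q : ℕ × ℕ => (hYm q.1 q.2).comap_le) hind
    (S := {q | q.1 < l}) (T := {q | q.1 = l})
    (Set.disjoint_left.2 fun q (h1 : q.1 < l) (h2 : q.1 = l) => h1.ne h2)
  have hn : MeasurableSet {ω | Z l ω = n} := hZm l (measurableSet_singleton n)
  have hle : ⨆ q ∈ {q : ℕ × ℕ | q.1 = l}, MeasurableSpace.comap (Y q.1 q.2) ⊤ ≤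
      ‹MeasurableSpace Ω› := iSup₂_le fun q _ => (hYm q.1 q.2).comap_le
  set m := ⨆ q ∈ {q : ℕ × ℕ | q.1 = l}, MeasurableSpace.comap (Y q.1 q.2) ⊤ with hm
  have hXm : Measurable[m] fun ω => ∏ i ∈ Finset.range n, s ^ Y l i ω := by
    let _ := m
    refine Finset.measurable_prod _ fun i _ => (measurable_from_nat (f := fun n => s ^ n)).comp ?_
    have : MeasurableSpace.comap (Y l i) ⊤ ≤ m :=
      le_biSup (fun q : ℕ × ℕ => MeasurableSpace.comap (Y q.1 q.2) ⊤)
        (show ((l, i) : ℕ × ℕ) ∈ {q : ℕ × ℕ | q.1 = l} from rfl)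
    exact (comap_measurable (Y l i)).mono this le_rfl
  have hif : IndepFun ({ω | Z l ω = n}.indicator fun _ => (1 : ℝ))
      (fun ω => ∏ i ∈ Finset.range n, s ^ Y l i ω) P := by
    refine indep_of_indep_of_le_left (indep_of_indep_of_le_right hindep hXm.comap_le) ?_
    refine Measurable.comap_le ?_
    exact measurable_const.indicator
      (measurable_generation_of_past h0 hZ l (measurableSet_singleton n))
  have hprod : ∫ ω, ∏ i ∈ Finset.range n, s ^ Y l i ω ∂P = (∑' k, p k * s ^ k) ^ n := by
    have hinj : Function.Injective fun i : Fin n => ((l, (i : ℕ)) : ℕ × ℕ) := fun i j hij => by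
      simpa [Fin.ext_iff] using hij
    have := (hind.precomp hinj).integral_fun_prod_comp (f := fun _ k => s ^ k)
      (fun i => (hYm l i).aemeasurable) (fun i => measurable_from_nat.aestronglyMeasurable)
    simp only [hG, Finset.prod_const, Finset.card_univ, Fintype.card_fin] at this
    rw [← this]
    simp_rw [Finset.prod_range]
  have hmul := hif.integral_mul_eq_mul_integral
    ((measurable_const.indicator (hZm l (measurableSet_singleton n))).aestronglyMeasurable)
    ((hXm.mono hle le_rfl).aestronglyMeasurable)
  rw [hprod, integral_indicator hn] at hmul
  simp only [integral_const, MeasurableSet.univ, measureReal_restrict_apply, Set.univ_inter,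
    smul_eq_mul, mul_one] at hmul
  rw [← hmul, ← integral_indicator hn]
  refine integral_congr_ae (ae_of_all _ fun ω => ?_)
  by_cases hω : Z l ω = n
  · have h1 : ω ∈ {ω | Z l ω = n} := hω
    simp only [Pi.mul_apply, Set.indicator_of_mem h1, one_mul, hZ l ω, hω]
    rw [Finset.prod_pow_eq_pow_sum]
  · have h1 : ω ∉ {ω | Z l ω = n} := hω
    simp [Set.indicator_of_notMem h1]

theorem IsGaltonWatson.hasSum_iterate [IsProbabilityMeasure P] (hGW : IsGaltonWatson P p Z) (L : ℕ) {s : ℝ}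
    (hs : |s| ≤ 1) :
    HasSum (fun n => P.real {ω | Z L ω = n} * s ^ n) ((fun s => ∑' k, p k * s ^ k)^[L] s) := by
  suffices h : ∫ ω, s ^ Z L ω ∂P = (fun s => ∑' k, p k * s ^ k)^[L] s by
    rw [← h]
    exact hasSum_measureReal_fiber_mul_pow (hGW.measurable L) hs
  induction L generalizing s with
  | zero =>
    obtain ⟨Y, hYm, hind, hp, h0, hZ⟩ := hGW
    simp [h0]
  | succ L ih =>
    have hG : |∑' k, p k * s ^ k| ≤ 1 := by
      -- Since `Z 0 = 1`, the case `l = 0` identifies `G(s)` with the expectation of `s ^ Z 1`.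
      have h1 := hGW.integral_pow_succ 0 hs
      obtain ⟨Y, hYm, hind, hp, h0, hZ⟩ := hGW
      simp only [h0, pow_one, integral_const, probReal_univ, smul_eq_mul, one_mul] at h1
      rw [← h1]
      exact abs_integral_pow_le_one hs
    rw [hGW.integral_pow_succ L hs, ih hG, Function.iterate_succ_apply]

end GaltonWatson

/-! ### Harmonic polynomials -/

section Harmonic

open MvPolynomial

variable {d : ℕ}

theorem polyLaplacian_apply (q : MvPolynomial (Fin d) ℝ) :
    polyLaplacian d q = ∑ i, pderiv i (pderiv i q) := by
  simp [polyLaplacian]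

/-- The polynomial `∑ᵢ xᵢ²`. -/
def polyNormSq (d : ℕ) : MvPolynomial (Fin d) ℝ := ∑ i, X i ^ 2

theorem pderiv_polyNormSq (i : Fin d) : pderiv i (polyNormSq d) = 2 * X i := by
  classical
  simp only [polyNormSq, map_sum, pderiv_pow, pderiv_X]
  rw [Finset.sum_eq_single i] <;> simp +contextual [eq_comm]

theorem isHomogeneous_polyNormSq : (polyNormSq d).IsHomogeneous 2 :=
  IsHomogeneous.sum _ _ _ fun i _ => by simpa using (isHomogeneous_X ℝ i).pow 2

theorem polyLaplacian_isHomogeneous {q : MvPolynomial (Fin d) ℝ} {n : ℕ} (hq : q.IsHomogeneous n) :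
    (polyLaplacian d q).IsHomogeneous (n - 2) := by
  rw [polyLaplacian_apply]
  exact IsHomogeneous.sum _ _ _ fun i _ => hq.pderiv.pderiv

/-- Leibniz: `2d` is the Laplacian of `|x|²`, and the cross term `4 x · ∇q` equals `4n q` by Euler's
identity. -/
theorem polyLaplacian_normSq_mul {q : MvPolynomial (Fin d) ℝ} {n : ℕ} (hq : q.IsHomogeneous n) :
    polyLaplacian d (polyNormSq d * q) =
      C (2 * d + 4 * n : ℝ) * q + polyNormSq d * polyLaplacian d q := by
  have h1 : ∀ i, pderiv i (pderiv i (polyNormSq d * q)) =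
      2 * q + 4 * (X i * pderiv i q) + polyNormSq d * pderiv i (pderiv i q) := fun i => by
    have h2 : pderiv i (2 : MvPolynomial (Fin d) ℝ) = 0 := by
      rw [show (2 : MvPolynomial (Fin d) ℝ) = C 2 from (map_ofNat C 2).symm, pderiv_C]
    simp only [pderiv_mul, pderiv_polyNormSq, map_add, h2, pderiv_X_self]
    ring
  have h2 : (C 2 : MvPolynomial (Fin d) ℝ) = 2 := map_ofNat C 2
  have h4 : (C 4 : MvPolynomial (Fin d) ℝ) = 4 := map_ofNat C 4
  simp only [polyLaplacian_apply, h1, Finset.sum_add_distrib, ← Finset.mul_sum,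
    hq.sum_X_mul_pderiv]
  simp [h2, h4]
  ring

theorem polyLaplacian_normSq_pow_mul (hd : 0 < d) {h : MvPolynomial (Fin d) ℝ} {m : ℕ}
    (hm : h.IsHomogeneous m) (hh : polyLaplacian d h = 0) (j : ℕ) :
    ∃ c : ℝ, 0 < c ∧
      polyLaplacian d (polyNormSq d ^ (j + 1) * h) = C c * (polyNormSq d ^ j * h) := by
  induction j with
  | zero =>
    refine ⟨2 * d + 4 * m, by positivity, ?_⟩
    simp [polyLaplacian_normSq_mul hm, hh]
  | succ j ih =>
    obtain ⟨c, hc, hcj⟩ := ih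
    have hhom : (polyNormSq d ^ (j + 1) * h).IsHomogeneous (2 * (j + 1) + m) :=
      (isHomogeneous_polyNormSq.pow (j + 1)).mul hm
    refine ⟨2 * d + 4 * (2 * (j + 1) + m : ℕ) + c, by positivity, ?_⟩
    rw [pow_succ', mul_assoc, polyLaplacian_normSq_mul hhom, hcj]
    simp
    ring

/-- The span of the polynomials `|x|^{2j} h`, with `h` harmonic and homogeneous, which are
homogeneous of degree `n`. -/
def harmonicSpan (d n : ℕ) : Submodule ℝ (MvPolynomial (Fin d) ℝ) :=
  Submodule.span ℝ {q | ∃ j m h, 2 * j + m = n ∧ h.IsHomogeneous m ∧ polyLaplacian d h = 0 ∧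
    q = polyNormSq d ^ j * h}

theorem harmonicSpan_le (n : ℕ) : harmonicSpan d n ≤ homogeneousSubmodule (Fin d) ℝ n :=
  Submodule.span_le.2 fun q ⟨j, m, h, hn, hm, _, hq⟩ => by
    rw [hq, ← hn]
    exact (isHomogeneous_polyNormSq.pow j).mul hm

/-- The Laplacian lowers the exponent of `|x|²` by one up to a nonzero constant, so dividing by that
constant inverts it on generators. -/
theorem exists_laplacian_eq (hd : 0 < d) {n : ℕ} {v : MvPolynomial (Fin d) ℝ}
    (hv : v ∈ harmonicSpan d n) : ∃ u ∈ harmonicSpan d (n + 2), polyLaplacian d u = v := by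
  refine Submodule.span_induction (p := fun v _ => ∃ u ∈ harmonicSpan d (n + 2),
    polyLaplacian d u = v) ?_ ⟨0, zero_mem _, map_zero _⟩ ?_ ?_ hv
  · rintro q ⟨j, m, h, hn, hm, hh, rfl⟩
    obtain ⟨c, hc, hcj⟩ := polyLaplacian_normSq_pow_mul hd hm hh j
    refine ⟨c⁻¹ • (polyNormSq d ^ (j + 1) * h), Submodule.smul_mem _ _
      (Submodule.subset_span ⟨j + 1, m, h, by omega, hm, hh, rfl⟩), ?_⟩
    rw [map_smul, hcj, ← smul_eq_C_mul, smul_smul, inv_mul_cancel₀ hc.ne', one_smul]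
  · rintro _ _ _ _ ⟨u, hu, rfl⟩ ⟨w, hw, rfl⟩
    exact ⟨u + w, add_mem hu hw, map_add _ _ _⟩
  · rintro a _ _ ⟨u, hu, rfl⟩
    exact ⟨a • u, Submodule.smul_mem _ _ hu, map_smul _ _ _⟩

/-- Induction in steps of two: the Laplacian of `q` lies in the span in degree `n - 2`, hence is the
Laplacian of some `u` in the span, and `q - u` is harmonic. -/
theorem mem_harmonicSpan (hd : 0 < d) {n : ℕ} {q : MvPolynomial (Fin d) ℝ}
    (hq : q.IsHomogeneous n) : q ∈ harmonicSpan d n := by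
  induction n using Nat.strong_induction_on generalizing q with
  | _ n ih =>
    have hharm : ∀ {h : MvPolynomial (Fin d) ℝ}, h.IsHomogeneous n → polyLaplacian d h = 0 →
        h ∈ harmonicSpan d n := fun {h} hm hh =>
      Submodule.subset_span ⟨0, n, h, by simp, hm, hh, by simp⟩
    match n with
    | 0 | 1 =>
      refine hharm hq ?_
      rw [polyLaplacian_apply]
      refine Finset.sum_eq_zero fun i _ => ?_
      have h0 : (pderiv i q).IsHomogeneous 0 := by simpa using hq.pderiv (i := i)
      rw [← totalDegree_zero_iff_isHomogeneous, totalDegree_eq_zero_iff_eq_C] at h0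
      rw [h0, pderiv_C]
    | n + 2 =>
      obtain ⟨u, hu, hΔ⟩ := exists_laplacian_eq hd
        (ih n (by omega) (by simpa using polyLaplacian_isHomogeneous hq))
      have : q - u ∈ harmonicSpan d (n + 2) :=
        hharm (Submodule.sub_mem (homogeneousSubmodule (Fin d) ℝ (n + 2)) hq
          (harmonicSpan_le _ hu)) (by rw [map_sub, hΔ, sub_self])
      simpa using add_mem this hu

theorem eval_polyNormSq (x : UnitSphere d) :
    eval (fun i => (x : EuclideanSpace ℝ (Fin d)) i) (polyNormSq d) = 1 := by
  have h : ‖(x : EuclideanSpace ℝ (Fin d))‖ = 1 := by simp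
  have := EuclideanSpace.real_norm_sq_eq (x : EuclideanSpace ℝ (Fin d))
  rw [h] at this
  simpa [polyNormSq] using this.symm

/-- On the sphere, homogeneous polynomials of degree `n` are sums of spherical harmonics of
degrees at most `n`. -/
theorem restrictToSphere_mem_iSup (hd : 0 < d) {n : ℕ} {q : MvPolynomial (Fin d) ℝ}
    (hq : q.IsHomogeneous n) :
    restrictToSphere d q ∈ ⨆ k : Finset.range (n + 1), sphericalHarmonics d k := by
  suffices h : harmonicSpan d n ≤
      (⨆ k : Finset.range (n + 1), sphericalHarmonics d k).comap (restrictToSphere d) from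
    h (mem_harmonicSpan hd hq)
  refine Submodule.span_le.2 ?_
  rintro _ ⟨j, m, h, hn, hm, hh, rfl⟩
  have hmem : restrictToSphere d h ∈ sphericalHarmonics d m := ⟨h, ⟨hm, hh⟩, rfl⟩
  have heq : restrictToSphere d (polyNormSq d ^ j * h) = restrictToSphere d h := by
    ext x
    simp [restrictToSphere, eval_polyNormSq]
  rw [SetLike.mem_coe, Submodule.mem_comap, heq]
  exact Submodule.mem_iSup_of_mem
    (⟨m, Finset.mem_range.2 (by omega)⟩ : Finset.range (n + 1)) hmem

set_option maxHeartbeats 800000 in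
/-- In dimension at least two there is a harmonic polynomial of each degree which does not vanish
on the sphere. -/
theorem exists_harmonic_eval_eq_one (hd : 2 ≤ d) (k : ℕ) :
    ∃ A : MvPolynomial (Fin d) ℝ, A.IsHomogeneous k ∧ polyLaplacian d A = 0 ∧
      ∃ x : UnitSphere d, eval (fun i => (x : EuclideanSpace ℝ (Fin d)) i) A = 1 := by
  classical
  set a : Fin d := ⟨0, by omega⟩
  set b : Fin d := ⟨1, by omega⟩
  have hab : a ≠ b := by simp [a, b, Fin.ext_iff]
  -- `A` and `B` are the real and imaginary parts of `(x_a + i x_b)^k`, and `A'`, `B'` those of the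
  -- power `k - 1`. The derivative identities are the Cauchy–Riemann equations; the factorisation is
  -- only demanded for `k ≠ 0`.
  suffices h : ∃ A B : MvPolynomial (Fin d) ℝ, A.IsHomogeneous k ∧ B.IsHomogeneous k ∧
      (∃ A' B', pderiv a A = C (k : ℝ) * A' ∧ pderiv b A = - (C (k : ℝ) * B') ∧
        pderiv a B = C (k : ℝ) * B' ∧ pderiv b B = C (k : ℝ) * A' ∧
        (k ≠ 0 → A = X a * A' - X b * B' ∧ B = X a * B' + X b * A')) ∧
      polyLaplacian d A = 0 ∧ polyLaplacian d B = 0 ∧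
      (∀ i, i ≠ a → i ≠ b → pderiv i A = 0 ∧ pderiv i B = 0) ∧
      eval (Pi.single a 1) A = 1 by
    obtain ⟨A, B, hA, -, -, hΔ, -, -, he⟩ := h
    refine ⟨A, hA, hΔ, ⟨EuclideanSpace.single a 1, by simp⟩, ?_⟩
    refine Eq.trans ?_ he
    congr 2
  induction k with
  | zero =>
    exact ⟨1, 0, isHomogeneous_one _ _, isHomogeneous_zero _ _ _, ⟨0, 0, by simp⟩,
      by simp [polyLaplacian_apply], by simp, by simp, by simp⟩
  | succ k ih =>
    obtain ⟨A, B, hA, hB, ⟨A', B', h1, h2, h3, h4, h5⟩, hΔA, hΔB, h0, he⟩ := ih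
    -- The factor `k` makes the identity hold at `k = 0` as well, where no factorisation is
    -- available.
    have e1 : C (k : ℝ) * A = C (k : ℝ) * (X a * A' - X b * B') := by
      rcases eq_or_ne k 0 with rfl | hk
      · simp
      · rw [(h5 hk).1]
    have e2 : C (k : ℝ) * B = C (k : ℝ) * (X a * B' + X b * A') := by
      rcases eq_or_ne k 0 with rfl | hk
      · simp
      · rw [(h5 hk).2]
    have hXab : pderiv a (X b : MvPolynomial (Fin d) ℝ) = 0 := pderiv_X_of_ne hab.symm
    have hXba : pderiv b (X a : MvPolynomial (Fin d) ℝ) = 0 := pderiv_X_of_ne hab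
    have hC : C ((k + 1 : ℕ) : ℝ) = (C (k : ℝ) + 1 : MvPolynomial (Fin d) ℝ) := by simp
    have d1 : pderiv a (X a * A - X b * B) = C ((k + 1 : ℕ) : ℝ) * A := by
      simp only [map_sub, pderiv_mul, hXab, pderiv_X_self, h1, h3, hC]
      linear_combination -e1
    have d2 : pderiv b (X a * A - X b * B) = -(C ((k + 1 : ℕ) : ℝ) * B) := by
      simp only [map_sub, pderiv_mul, hXba, pderiv_X_self, h2, h4, hC]
      linear_combination e2
    have d3 : pderiv a (X a * B + X b * A) = C ((k + 1 : ℕ) : ℝ) * B := by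
      simp only [map_add, pderiv_mul, hXab, pderiv_X_self, h1, h3, hC]
      linear_combination -e2
    have d4 : pderiv b (X a * B + X b * A) = C ((k + 1 : ℕ) : ℝ) * A := by
      simp only [map_add, pderiv_mul, hXba, pderiv_X_self, h2, h4, hC]
      linear_combination -e1
    have d0 : ∀ i, i ≠ a → i ≠ b →
        pderiv i (X a * A - X b * B) = 0 ∧ pderiv i (X a * B + X b * A) = 0 := fun i hia hib => by
      have := h0 i hia hib
      simp [this.1, this.2, pderiv_X_of_ne hia.symm, pderiv_X_of_ne hib.symm]
    have hsum : ∀ q : MvPolynomial (Fin d) ℝ, (∀ i, i ≠ a → i ≠ b → pderiv i q = 0) →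
        polyLaplacian d q = pderiv a (pderiv a q) + pderiv b (pderiv b q) := fun q hq => by
      rw [polyLaplacian_apply, ← Finset.sum_pair (f := fun i => pderiv i (pderiv i q)) hab]
      refine (Finset.sum_subset (Finset.subset_univ _) fun i _ hi => ?_).symm
      simp only [Finset.mem_insert, Finset.mem_singleton, not_or] at hi
      rw [hq i hi.1 hi.2, map_zero]
    refine ⟨X a * A - X b * B, X a * B + X b * A, ?_, ?_, ⟨A, B, d1, d2, d3, d4, fun _ => ⟨rfl, rfl⟩⟩,
      ?_, ?_, d0, ?_⟩
    · rw [add_comm k 1]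
      exact ((isHomogeneous_X ℝ a).mul hA).sub ((isHomogeneous_X ℝ b).mul hB)
    · rw [add_comm k 1]
      exact ((isHomogeneous_X ℝ a).mul hB).add ((isHomogeneous_X ℝ b).mul hA)
    · rw [hsum _ fun i hia hib => (d0 i hia hib).1, d1, d2]
      simp only [pderiv_C_mul, map_neg, h1, h4]
      ring
    · rw [hsum _ fun i hia hib => (d0 i hia hib).2, d3, d4]
      simp only [pderiv_C_mul, h2, h3]
      ring
    · simp [he, hab.symm]

end Harmonic

/-! ### Gaussian integrals of polynomials -/

section GaussianIntegral

open MvPolynomial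

variable {d : ℕ}

theorem integrable_eval_mul_exp (q : MvPolynomial (Fin d) ℝ) :
    Integrable fun x : EuclideanSpace ℝ (Fin d) =>
      eval (fun i => x i) q * Real.exp (-‖x‖ ^ 2 / 2) := by
  induction q using MvPolynomial.induction_on' with
  | monomial m a =>
    have h1 : ∀ i : Fin d, Integrable fun t : ℝ => t ^ m i * Real.exp (-(1 / 2) * t ^ 2) := fun i => by
      have := integrable_rpow_mul_exp_neg_mul_sq (b := 1 / 2) (by norm_num) (s := (m i : ℝ))
        (lt_of_lt_of_le (by norm_num) (Nat.cast_nonneg _))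
      simpa only [Real.rpow_natCast] using this
    have h2 := (PiLp.volume_preserving_ofLp (Fin d)).integrable_comp_of_integrable
      (Integrable.fintype_prod (μ := fun _ => volume) h1)
    refine (h2.const_mul a).congr (ae_of_all _ fun x => ?_)
    simp only [Function.comp_apply, eval_monomial]
    rw [Finsupp.prod_fintype _ _ (fun i => pow_zero _), Finset.prod_mul_distrib, ← Real.exp_sum,
      ← Finset.mul_sum, ← EuclideanSpace.real_norm_sq_eq, mul_assoc]
    congr 3
    ring
  | add p q hp hq =>
    refine (hp.add hq).congr (ae_of_all _ fun x => ?_)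
    simp [add_mul]

/-- The unnormalized Gaussian integral of a polynomial. -/
def polyGaussIntegral (d : ℕ) : MvPolynomial (Fin d) ℝ →ₗ[ℝ] ℝ where
  toFun q := ∫ x : EuclideanSpace ℝ (Fin d), eval (fun i => x i) q * Real.exp (-‖x‖ ^ 2 / 2)
  map_add' p q := by
    rw [← integral_add (integrable_eval_mul_exp p) (integrable_eval_mul_exp q)]
    simp [add_mul]
  map_smul' c q := by
    simp [MvPolynomial.smul_eval, mul_assoc, integral_const_mul]

theorem hasLineDerivAt_eval (q : MvPolynomial (Fin d) ℝ) (x : EuclideanSpace ℝ (Fin d))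
    (i : Fin d) :
    HasLineDerivAt ℝ (fun x : EuclideanSpace ℝ (Fin d) => eval (fun j => x j) q)
      (eval (fun j => x j) (pderiv i q)) x (EuclideanSpace.single i 1) := by
  classical
  unfold HasLineDerivAt
  induction q using MvPolynomial.induction_on with
  | C a => simpa using hasDerivAt_const (0 : ℝ) a
  | add p q hp hq =>
    simp only [map_add]
    exact hp.add hq
  | mul_X p j hp =>
    have hX : HasDerivAt (fun t : ℝ => (x + t • EuclideanSpace.single i (1 : ℝ)) j)
        (eval (fun j => x j) (pderiv i (X j : MvPolynomial (Fin d) ℝ))) 0 := by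
      have := ((hasDerivAt_id (0 : ℝ)).mul_const (EuclideanSpace.single i (1 : ℝ) j)).const_add (x j)
      refine (this.congr_deriv ?_).congr_of_eventuallyEq (Filter.Eventually.of_forall fun t => ?_)
      · rcases eq_or_ne j i with rfl | h
        · simp
        · simp [h, pderiv_X_of_ne h]
      · simp
    have := hp.mul hX
    simp only [eval_mul, eval_X, pderiv_mul, eval_add]
    refine this.congr_deriv ?_
    simp

theorem hasLineDerivAt_exp_norm_sq (x : EuclideanSpace ℝ (Fin d)) (i : Fin d) :
    HasLineDerivAt ℝ (fun x : EuclideanSpace ℝ (Fin d) => Real.exp (-‖x‖ ^ 2 / 2))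
      (-(x i * Real.exp (-‖x‖ ^ 2 / 2))) x (EuclideanSpace.single i 1) := by
  unfold HasLineDerivAt
  have h : ∀ t : ℝ, ‖x + t • EuclideanSpace.single i (1 : ℝ)‖ ^ 2 = ‖x‖ ^ 2 + 2 * t * x i + t ^ 2 :=
    fun t => by
      rw [norm_add_sq_real, inner_smul_right, norm_smul]
      simp [EuclideanSpace.inner_single_right, mul_assoc]
  simp only [h]
  have h1 : HasDerivAt (fun t : ℝ => -(‖x‖ ^ 2 + 2 * t * x i + t ^ 2) / 2)
      (-(2 * x i + 2 * (0 : ℝ) ^ (2 - 1)) / 2) 0 := by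
    have := ((((hasDerivAt_id (0 : ℝ)).const_mul 2).mul_const (x i)).const_add (‖x‖ ^ 2)).add
      (hasDerivAt_pow 2 (0 : ℝ))
    simpa using (this.neg.div_const 2)
  refine h1.exp.congr_deriv ?_
  simp
  ring

/-- Gaussian integration by parts. -/
theorem polyGaussIntegral_X_mul (i : Fin d) (q : MvPolynomial (Fin d) ℝ) :
    polyGaussIntegral d (X i * q) = polyGaussIntegral d (pderiv i q) := by
  have hX := integrable_eval_mul_exp (X i * q)
  have hneg : ∀ x : EuclideanSpace ℝ (Fin d),
      eval (fun j => x j) q * -(x i * Real.exp (-‖x‖ ^ 2 / 2)) =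
        -(eval (fun j => x j) (X i * q) * Real.exp (-‖x‖ ^ 2 / 2)) := fun x => by
    simp
    ring
  have := integral_bilinear_hasLineDerivAt_right_eq_neg_left_of_integrable
    (μ := (volume : Measure (EuclideanSpace ℝ (Fin d)))) (B := ContinuousLinearMap.mul ℝ ℝ)
    (f := fun x => eval (fun j => x j) q) (f' := fun x => eval (fun j => x j) (pderiv i q))
    (g := fun x => Real.exp (-‖x‖ ^ 2 / 2)) (g' := fun x => -(x i * Real.exp (-‖x‖ ^ 2 / 2)))
    (v := EuclideanSpace.single i 1)
    (integrable_eval_mul_exp _)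
    (hX.neg.congr (ae_of_all _ fun x => (hneg x).symm))
    (integrable_eval_mul_exp _)
    (fun x _ => hasLineDerivAt_eval q x i) (fun x _ => hasLineDerivAt_exp_norm_sq x i)
  simp only [ContinuousLinearMap.mul_apply', hneg, integral_neg, neg_inj] at this
  exact this

/-- Euler's identity integrated by parts. A harmonic polynomial of positive degree therefore has
Gaussian integral zero. -/
theorem polyGaussIntegral_laplacian {q : MvPolynomial (Fin d) ℝ} {k : ℕ} (hq : q.IsHomogeneous k) :
    polyGaussIntegral d (polyLaplacian d q) = k * polyGaussIntegral d q := by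
  have := congrArg (polyGaussIntegral d) hq.sum_X_mul_pderiv
  rw [map_nsmul, nsmul_eq_mul] at this
  simpa [polyGaussIntegral_X_mul, polyLaplacian_apply] using this

/-- Harmonic polynomials of different degrees are orthogonal for the Gaussian measure. -/
theorem polyGaussIntegral_mul_eq_zero {p q : MvPolynomial (Fin d) ℝ} {k l : ℕ}
    (hp : p.IsHomogeneous k) (hq : q.IsHomogeneous l) (hp0 : polyLaplacian d p = 0)
    (hq0 : polyLaplacian d q = 0) (hkl : k ≠ l) : polyGaussIntegral d (p * q) = 0 := by
  -- Euler's identity for `p`, times `q`, integrated by parts; the Laplacian term drops. The right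
  -- side is symmetric in `p` and `q`, so the integral of `p * q` has the same multiple by `k` and
  -- by `l`.
  have key : ∀ {p q : MvPolynomial (Fin d) ℝ} {k : ℕ}, p.IsHomogeneous k → polyLaplacian d p = 0 →
      (k : ℝ) * polyGaussIntegral d (p * q) =
        ∑ i, polyGaussIntegral d (pderiv i p * pderiv i q) := fun {p q k} hp hp0 => by
    have h := congrArg (fun r => polyGaussIntegral d (r * q)) hp.sum_X_mul_pderiv
    simp only [Finset.sum_mul, map_sum, mul_assoc, polyGaussIntegral_X_mul, pderiv_mul, map_add,
      Finset.sum_add_distrib] at h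
    have h0 := congrArg (fun r => polyGaussIntegral d (r * q)) hp0
    simp only [polyLaplacian_apply, Finset.sum_mul, map_sum, zero_mul, map_zero] at h0
    rw [h0, zero_add] at h
    rw [h, smul_mul_assoc, map_nsmul, nsmul_eq_mul]
  have h1 := key (q := q) hp hp0
  have h2 := key (q := p) hq hq0
  simp only [mul_comm (pderiv _ q), mul_comm q p] at h2
  rw [← h2] at h1
  have : ((k : ℝ) - l) * polyGaussIntegral d (p * q) = 0 := by rw [sub_mul, h1, sub_self]
  refine (mul_eq_zero.1 this).resolve_left (sub_ne_zero.2 (by exact_mod_cast hkl))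

/-- The moments of the standard normal distribution. -/
def normalMoment : ℕ → ℝ
  | 0 => 1
  | 1 => 0
  | n + 2 => (n + 1) * normalMoment n

theorem normalMoment_nonneg : ∀ n, 0 ≤ normalMoment n
  | 0 => zero_le_one
  | 1 => le_rfl
  | n + 2 => by
    rw [normalMoment]
    exact mul_nonneg (by positivity) (normalMoment_nonneg n)

/-- The pairing `E[gⁿ Heₖ(g)]` of a monomial with a Hermite polynomial. -/
def hermiteMoment (n k : ℕ) : ℝ := n.descFactorial k * normalMoment (n - k)

theorem hermiteMoment_nonneg (n k : ℕ) : 0 ≤ hermiteMoment n k :=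
  mul_nonneg (Nat.cast_nonneg _) (normalMoment_nonneg _)

theorem hermiteMoment_of_lt {n k : ℕ} (h : n < k) : hermiteMoment n k = 0 := by
  simp [hermiteMoment, Nat.descFactorial_eq_zero_iff_lt.2 h]

theorem hermiteMoment_add (k l : ℕ) :
    hermiteMoment (k + l) k = ((k + l).factorial : ℝ) / (l.factorial : ℝ) * normalMoment l := by
  have : (l.factorial : ℝ) ≠ 0 := by positivity
  have h := Nat.factorial_mul_descFactorial (Nat.le_add_right k l)
  simp only [Nat.add_sub_cancel_left] at h
  rw [hermiteMoment, Nat.add_sub_cancel_left, ← h]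
  push_cast
  field_simp

/-- This is Gaussian integration by parts for `E[g · gⁿ⁺¹ Heₖ₊₁(g)]`, using that the derivative of
`Heₖ₊₁` is `(k + 1) Heₖ`. -/
theorem hermiteMoment_succ_succ (n k : ℕ) :
    hermiteMoment (n + 2) (k + 1) =
      (n + 1) * hermiteMoment n (k + 1) + (k + 1) * hermiteMoment (n + 1) k := by
  rcases le_or_gt (k + 1) n with h | h
  · obtain ⟨l, rfl⟩ := Nat.exists_eq_add_of_le h
    have e1 := hermiteMoment_add (k + 1) l
    have e2 := hermiteMoment_add (k + 1) (l + 2)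
    have e3 := hermiteMoment_add k (l + 2)
    rw [show k + 1 + l + 2 = k + 1 + (l + 2) by ring, show k + 1 + l + 1 = k + (l + 2) by ring,
      e1, e2, e3, normalMoment, show k + 1 + (l + 2) = (k + 1 + l) + 1 + 1 by ring,
      show k + (l + 2) = (k + 1 + l) + 1 by ring]
    simp only [Nat.factorial_succ]
    push_cast
    field_simp
    ring
  · rw [hermiteMoment_of_lt h]
    rcases (show n = k ∨ n + 1 = k ∨ n + 1 < k by omega) with rfl | rfl | h'
    · simp [hermiteMoment, normalMoment, show n + 2 - (n + 1) = 1 by omega]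
    · have e1 := hermiteMoment_add (n + 2) 0
      have e2 := hermiteMoment_add (n + 1) 0
      simp only [Nat.add_zero, normalMoment, Nat.factorial_succ] at e1 e2
      rw [e1, e2]
      push_cast
      ring
    · rw [hermiteMoment_of_lt h', hermiteMoment_of_lt (by omega)]
      simp

/-- The linear form `⟨a, ·⟩`. -/
def linForm (a : Fin d → ℝ) : MvPolynomial (Fin d) ℝ := ∑ i, C (a i) * X i

theorem isHomogeneous_linForm (a : Fin d → ℝ) : (linForm a).IsHomogeneous 1 :=
  IsHomogeneous.sum _ _ _ fun i _ => by simpa using (isHomogeneous_C _ (a i)).mul (isHomogeneous_X ℝ i)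

theorem eval_linForm (a x : Fin d → ℝ) : eval x (linForm a) = ∑ i, a i * x i := by
  simp [linForm]

theorem pderiv_linForm (a : Fin d → ℝ) (i : Fin d) : pderiv i (linForm a) = C (a i) := by
  classical
  simp only [linForm, map_sum, pderiv_C_mul, pderiv_X]
  rw [Finset.sum_eq_single i] <;> simp +contextual [eq_comm]

/-- The directional derivative `a · ∇`. -/
def dirDeriv (a : Fin d → ℝ) : MvPolynomial (Fin d) ℝ →ₗ[ℝ] MvPolynomial (Fin d) ℝ :=
  ∑ i, a i • (pderiv i).toLinearMap

theorem dirDeriv_apply (a : Fin d → ℝ) (q : MvPolynomial (Fin d) ℝ) :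
    dirDeriv a q = ∑ i, C (a i) * pderiv i q := by
  simp [dirDeriv, smul_eq_C_mul]

theorem dirDeriv_mul (a : Fin d → ℝ) (p q : MvPolynomial (Fin d) ℝ) :
    dirDeriv a (p * q) = dirDeriv a p * q + p * dirDeriv a q := by
  simp only [dirDeriv_apply, pderiv_mul, Finset.sum_mul, Finset.mul_sum, ← Finset.sum_add_distrib]
  exact Finset.sum_congr rfl fun i _ => by ring

theorem dirDeriv_linForm_pow (a : Fin d → ℝ) (ha : ∑ i, a i ^ 2 = 1) (n : ℕ) :
    dirDeriv a (linForm a ^ (n + 1)) = C (n + 1 : ℝ) * linForm a ^ n := by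
  have h1 : dirDeriv a (linForm a) = 1 := by
    simp only [dirDeriv_apply, pderiv_linForm, ← C_mul, ← map_sum]
    rw [← C_1, ← ha]
    simp only [sq]
  induction n with
  | zero => simp [h1]
  | succ n ih =>
    rw [pow_succ, dirDeriv_mul, ih, h1]
    simp
    ring

theorem isHomogeneous_dirDeriv (a : Fin d → ℝ) {q : MvPolynomial (Fin d) ℝ} {k : ℕ}
    (hq : q.IsHomogeneous k) : (dirDeriv a q).IsHomogeneous (k - 1) := by
  rw [dirDeriv_apply]
  exact IsHomogeneous.sum _ _ _ fun i _ => by simpa using (isHomogeneous_C _ (a i)).mul hq.pderiv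

theorem pderiv_comm (i j : Fin d) (q : MvPolynomial (Fin d) ℝ) :
    pderiv i (pderiv j q) = pderiv j (pderiv i q) := by
  classical
  have h : ⁅pderiv (R := ℝ) i, pderiv (R := ℝ) j⁆ = 0 := by
    refine MvPolynomial.derivation_ext fun k => ?_
    simp only [Derivation.commutator_apply, pderiv_X, Derivation.zero_apply, Pi.single_apply]
    split_ifs <;> simp
  have := DFunLike.congr_fun h q
  simpa [Derivation.commutator_apply, sub_eq_zero] using this

/-- Differential operators with constant coefficients commute. -/
theorem polyLaplacian_dirDeriv (a : Fin d → ℝ) {q : MvPolynomial (Fin d) ℝ}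
    (hq : polyLaplacian d q = 0) : polyLaplacian d (dirDeriv a q) = 0 := by
  have h : polyLaplacian d (dirDeriv a q) = dirDeriv a (polyLaplacian d q) := by
    simp only [polyLaplacian_apply, dirDeriv_apply, map_sum, pderiv_C_mul]
    rw [Finset.sum_comm]
    refine Finset.sum_congr rfl fun i _ => Finset.sum_congr rfl fun j _ => ?_
    rw [pderiv_comm j i, pderiv_comm j i]
  rw [h, hq, map_zero]

theorem eval_dirDeriv_self (a : Fin d → ℝ) {q : MvPolynomial (Fin d) ℝ} {k : ℕ}
    (hq : q.IsHomogeneous k) : eval a (dirDeriv a q) = k * eval a q := by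
  have := congrArg (eval a) hq.sum_X_mul_pderiv
  simpa [dirDeriv_apply] using this

theorem polyGaussIntegral_linForm_mul (a : Fin d → ℝ) (q : MvPolynomial (Fin d) ℝ) :
    polyGaussIntegral d (linForm a * q) = polyGaussIntegral d (dirDeriv a q) := by
  simp only [linForm, dirDeriv_apply, Finset.sum_mul, map_sum, ← smul_eq_C_mul,
    smul_mul_assoc, map_smul, polyGaussIntegral_X_mul]

/-- The Gaussian form of the Funk–Hecke formula for monomials. -/
theorem polyGaussIntegral_linForm_pow_mul (a : Fin d → ℝ) (ha : ∑ i, a i ^ 2 = 1) (n : ℕ) {k : ℕ}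
    {q : MvPolynomial (Fin d) ℝ} (hq : q.IsHomogeneous k) (hq0 : polyLaplacian d q = 0) :
    polyGaussIntegral d (linForm a ^ n * q) =
      hermiteMoment n k * eval a q * polyGaussIntegral d 1 := by
  have hconst : ∀ {q : MvPolynomial (Fin d) ℝ}, q.IsHomogeneous 0 → ∃ c, q = C c := fun {q} hq => by
    rw [← totalDegree_zero_iff_isHomogeneous, totalDegree_eq_zero_iff_eq_C] at hq
    exact ⟨_, hq⟩
  have hC : ∀ c : ℝ, (C c : MvPolynomial (Fin d) ℝ) = c • 1 := fun c => by
    rw [smul_eq_C_mul, mul_one]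
  induction n using Nat.strong_induction_on generalizing k q with
  | _ n ih =>
    match n, k with
    | 0, 0 =>
      obtain ⟨c, rfl⟩ := hconst hq
      rw [pow_zero, one_mul, hC, map_smul]
      simp [hermiteMoment, normalMoment]
    | 0, k + 1 =>
      have := polyGaussIntegral_laplacian hq
      rw [hq0, map_zero] at this
      have h0 : polyGaussIntegral d q = 0 :=
        (mul_eq_zero.1 this.symm).resolve_left (by positivity)
      rw [hermiteMoment_of_lt (Nat.succ_pos k)]
      simpa using h0
    | 1, 0 =>
      obtain ⟨c, rfl⟩ := hconst hq
      rw [pow_one, polyGaussIntegral_linForm_mul]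
      simp [hermiteMoment, normalMoment, dirDeriv_apply]
    | 1, k + 1 =>
      have h := ih 0 (by omega) (isHomogeneous_dirDeriv a hq) (polyLaplacian_dirDeriv a hq0)
      rw [pow_one, polyGaussIntegral_linForm_mul]
      rw [pow_zero, one_mul, eval_dirDeriv_self a hq] at h
      rw [h]
      rcases k with _ | k <;> simp [hermiteMoment, normalMoment]
    | n + 2, k =>
      -- One factor `⟨a, ·⟩` becomes a derivative along the unit vector `a`. It hits either the
      -- remaining power, or `q`, where it leaves a harmonic polynomial of lower degree.
      have h1 : polyGaussIntegral d (linForm a ^ (n + 2) * q) =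
          (n + 1) * polyGaussIntegral d (linForm a ^ n * q) +
            polyGaussIntegral d (linForm a ^ (n + 1) * dirDeriv a q) := by
        rw [pow_succ', mul_assoc, polyGaussIntegral_linForm_mul, dirDeriv_mul,
          dirDeriv_linForm_pow a ha, map_add, mul_assoc, ← smul_eq_C_mul, map_smul, smul_eq_mul]
      rw [h1, ih n (by omega) hq hq0]
      match k with
      | 0 =>
        obtain ⟨c, rfl⟩ := hconst hq
        simp [dirDeriv_apply, hermiteMoment, normalMoment]
        ring
      | k + 1 =>
        rw [ih (n + 1) (by omega) (isHomogeneous_dirDeriv a hq) (polyLaplacian_dirDeriv a hq0),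
          eval_dirDeriv_self a hq, hermiteMoment_succ_succ]
        simp only [Nat.add_sub_cancel, Nat.cast_add, Nat.cast_one]
        ring

end GaussianIntegral

/-! ### Integrals of polynomials over the sphere -/

section Sphere

open MvPolynomial

variable {d : ℕ}

/-- The radial integral `∫₀^∞ r^{d-1+m} e^{-r²/2} dr`. -/
def gaussRadial (d m : ℕ) : ℝ :=
  2 ^ (((d : ℝ) + m) / 2) * (1 / 2) * Real.Gamma (((d : ℝ) + m) / 2)

theorem gaussRadial_pos (hd : 0 < d) (m : ℕ) : 0 < gaussRadial d m := by
  have : 0 < Real.Gamma (((d : ℝ) + m) / 2) := Real.Gamma_pos_of_pos (by positivity)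
  unfold gaussRadial
  positivity

theorem integral_pow_mul_exp_eq_gaussRadial (hd : 0 < d) (m : ℕ) :
    ∫ r in Set.Ioi (0 : ℝ), r ^ (d - 1) * (r ^ m * Real.exp (-r ^ 2 / 2)) = gaussRadial d m := by
  have h := integral_rpow_mul_exp_neg_mul_rpow (p := 2) (q := ((d - 1 + m : ℕ) : ℝ)) (b := 1 / 2)
    (by norm_num) (lt_of_lt_of_le (by norm_num) (Nat.cast_nonneg _)) (by norm_num)
  have hq : ((d - 1 + m : ℕ) : ℝ) + 1 = d + m := by
    rw [← Nat.cast_succ, show (d - 1 + m).succ = d + m by omega, Nat.cast_add]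
  rw [hq] at h
  have h2 : (1 / 2 : ℝ) ^ (-((d : ℝ) + m) / 2) = 2 ^ (((d : ℝ) + m) / 2) := by
    rw [one_div, Real.inv_rpow (by norm_num), ← Real.rpow_neg (by norm_num)]
    congr 1
    ring
  rw [gaussRadial, ← h2, ← h]
  refine setIntegral_congr_fun measurableSet_Ioi fun r _ => ?_
  simp only [Real.rpow_natCast, Real.rpow_ofNat]
  rw [pow_add, mul_assoc]
  congr 3
  ring

theorem eval_smul_of_isHomogeneous {q : MvPolynomial (Fin d) ℝ} {m : ℕ} (hq : q.IsHomogeneous m)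
    (r : ℝ) (x : Fin d → ℝ) : eval (fun i => r * x i) q = r ^ m * eval x q := by
  simp only [eval_eq, Finset.mul_sum]
  refine Finset.sum_congr rfl fun s hs => ?_
  have hdeg : ∑ i, s i = m := by
    have := hq (mem_support_iff.1 hs)
    rw [← this, Finsupp.weight_apply, Finsupp.sum_fintype _ _ (by simp)]
    simp
  rw [← hdeg, ← Finset.prod_pow_eq_pow_sum]
  have : ∀ f : Fin d → ℝ, ∏ i ∈ s.support, f i ^ s i = ∏ i, f i ^ s i := fun f =>
    Finset.prod_subset (Finset.subset_univ _) fun i _ hi => by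
      rw [Finsupp.notMem_support_iff.1 hi, pow_zero]
  rw [this, this]
  simp only [mul_pow, Finset.prod_mul_distrib]
  ring

/-- Polar coordinates off the null set `{0}`: homogeneity splits the integrand into an angular
factor and `r ^ m e^{-r²/2}`. -/
theorem polyGaussIntegral_eq_mul_gaussRadial (hd : 0 < d) {q : MvPolynomial (Fin d) ℝ} {m : ℕ}
    (hq : q.IsHomogeneous m) :
    polyGaussIntegral d q = (∫ x, restrictToSphere d q x ∂(surfaceMeasure d)) * gaussRadial d m := by
  have : Nonempty (Fin d) := ⟨⟨0, hd⟩⟩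
  let E := EuclideanSpace ℝ (Fin d)
  have : Nontrivial E := inferInstanceAs (Nontrivial (EuclideanSpace ℝ (Fin d)))
  let μ : Measure E := volume
  have hdim : Module.finrank ℝ E = d := by simp [E]
  have h1 : polyGaussIntegral d q =
      ∫ x : ({(0 : E)}ᶜ : Set E), eval (fun i => x.1 i) q * Real.exp (-‖x.1‖ ^ 2 / 2)
        ∂(μ.comap (↑)) := by
    rw [integral_subtype_comap (measurableSet_singleton _).compl
      fun x : E => eval (fun i => x i) q * Real.exp (-‖x‖ ^ 2 / 2), restrict_compl_singleton]
    rfl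
  have h2 := μ.measurePreserving_homeomorphUnitSphereProd.integral_comp
    (Homeomorph.measurableEmbedding _)
    (fun p : UnitSphere d × Set.Ioi (0 : ℝ) =>
      restrictToSphere d q p.1 * ((p.2 : ℝ) ^ m * Real.exp (-(p.2 : ℝ) ^ 2 / 2)))
  rw [integral_prod_mul (fun x : UnitSphere d => restrictToSphere d q x)
    (fun r : Set.Ioi (0 : ℝ) => (r : ℝ) ^ m * Real.exp (-(r : ℝ) ^ 2 / 2))] at h2
  have h3 : ∫ r : Set.Ioi (0 : ℝ), (r : ℝ) ^ m * Real.exp (-(r : ℝ) ^ 2 / 2)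
      ∂(Measure.volumeIoiPow (Module.finrank ℝ E - 1)) = gaussRadial d m := by
    rw [hdim, ← integral_pow_mul_exp_eq_gaussRadial hd]
    simp only [Measure.volumeIoiPow, ENNReal.ofReal]
    rw [integral_withDensity_eq_integral_smul,
      integral_subtype_comap measurableSet_Ioi fun a : ℝ => Real.toNNReal (a ^ (d - 1)) •
        (a ^ m * Real.exp (-a ^ 2 / 2)),
      setIntegral_congr_fun measurableSet_Ioi fun x hx => ?_]
    · rw [NNReal.smul_def, Real.coe_toNNReal _ (pow_nonneg (le_of_lt hx) _), smul_eq_mul]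
    · exact (measurable_subtype_coe.pow_const _).real_toNNReal
  rw [h3] at h2
  rw [h1, surfaceMeasure, ← h2]
  refine integral_congr_ae (ae_of_all _ fun x => ?_)
  have hx : ‖x.1‖ ≠ 0 := norm_ne_zero_iff.2 x.2
  have : (fun i => x.1 i) = fun i => ‖x.1‖ * (‖x.1‖⁻¹ * x.1 i) := by
    ext i
    rw [mul_inv_cancel_left₀ hx]
  simp only [restrictToSphere, LinearMap.coe_mk, AddHom.coe_mk,
    homeomorphUnitSphereProd_apply_snd_coe, homeomorphUnitSphereProd_apply_fst_coe]
  rw [this, eval_smul_of_isHomogeneous hq]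
  change _ = eval (fun i => ‖x.1‖⁻¹ * x.1 i) q * _
  ring

theorem sphereArea_pos (hd : 0 < d) : 0 < sphereArea d := by
  have : Nonempty (Fin d) := ⟨⟨0, hd⟩⟩
  have : surfaceMeasure d ≠ 0 := Measure.toSphere_ne_zero _
  refine ENNReal.toReal_pos (by simpa using this) ?_
  unfold surfaceMeasure
  exact measure_ne_top _ _

theorem integral_sphereUniform (f : UnitSphere d → ℝ) :
    ∫ x, f x ∂(sphereUniform d) = (sphereArea d)⁻¹ * ∫ x, f x ∂(surfaceMeasure d) := by
  rw [sphereUniform, integral_smul_measure, ENNReal.toReal_inv, smul_eq_mul]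
  rfl

theorem isProbabilityMeasure_sphereUniform (hd : 0 < d) :
    IsProbabilityMeasure (sphereUniform d) := by
  have : Nonempty (Fin d) := ⟨⟨0, hd⟩⟩
  have h0 : surfaceMeasure d ≠ 0 := Measure.toSphere_ne_zero _
  have : IsFiniteMeasure (surfaceMeasure d) := by unfold surfaceMeasure; infer_instance
  constructor
  rw [sphereUniform, Measure.smul_apply, smul_eq_mul]
  exact ENNReal.inv_mul_cancel (by simpa using h0) (measure_ne_top _ _)

theorem polyGaussIntegral_one_pos (hd : 0 < d) : 0 < polyGaussIntegral d 1 := by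
  rw [polyGaussIntegral_eq_mul_gaussRadial hd (isHomogeneous_one _ _)]
  refine mul_pos ?_ (gaussRadial_pos hd 0)
  have : restrictToSphere d 1 = fun _ => 1 := by ext; simp [restrictToSphere]
  rw [this]
  simpa [sphereArea] using sphereArea_pos hd

theorem integral_restrictToSphere (hd : 0 < d) {q : MvPolynomial (Fin d) ℝ} {m : ℕ}
    (hq : q.IsHomogeneous m) :
    ∫ x, restrictToSphere d q x ∂(sphereUniform d) =
      polyGaussIntegral d q / polyGaussIntegral d 1 * (gaussRadial d 0 / gaussRadial d m) := by
  have h1 : restrictToSphere d 1 = fun _ => 1 := by ext; simp [restrictToSphere]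
  rw [integral_sphereUniform, polyGaussIntegral_eq_mul_gaussRadial hd hq,
    polyGaussIntegral_eq_mul_gaussRadial hd (isHomogeneous_one _ _), h1]
  have h2 : ∫ _ : UnitSphere d, (1 : ℝ) ∂(surfaceMeasure d) = sphereArea d := by simp [sphereArea]
  have := (sphereArea_pos hd).ne'
  have := (gaussRadial_pos hd 0).ne'
  have := (gaussRadial_pos hd m).ne'
  rw [h2]
  field_simp

/-- The eigenvalue of the kernel `⟨x, z⟩ⁿ` on the spherical harmonics of degree `k`. -/
def powEigenvalue (d n k : ℕ) : ℝ :=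
  hermiteMoment n k * (gaussRadial d 0 / gaussRadial d (n + k))

theorem powEigenvalue_nonneg (hd : 0 < d) (n k : ℕ) : 0 ≤ powEigenvalue d n k :=
  mul_nonneg (hermiteMoment_nonneg n k)
    (div_nonneg (gaussRadial_pos hd 0).le (gaussRadial_pos hd _).le)

theorem powEigenvalue_of_lt {n k : ℕ} (h : n < k) : powEigenvalue d n k = 0 := by
  rw [powEigenvalue, hermiteMoment_of_lt h, zero_mul]

theorem restrictToSphere_mul (p q : MvPolynomial (Fin d) ℝ) (x : UnitSphere d) :
    restrictToSphere d (p * q) x = restrictToSphere d p x * restrictToSphere d q x := by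
  simp [restrictToSphere]

theorem restrictToSphere_linForm_pow (x z : UnitSphere d) (n : ℕ) :
    restrictToSphere d (linForm (fun i => (x : EuclideanSpace ℝ (Fin d)) i) ^ n) z =
      inner ℝ (x : EuclideanSpace ℝ (Fin d)) z ^ n := by
  simp [restrictToSphere, eval_linForm, PiLp.inner_apply, mul_comm]

theorem continuous_restrictToSphere (q : MvPolynomial (Fin d) ℝ) :
    Continuous (restrictToSphere d q) := by
  have : Continuous fun x : Fin d → ℝ => eval x q := MvPolynomial.continuous_eval q
  refine this.comp (continuous_pi fun i => ?_)
  exact (EuclideanSpace.proj i).continuous.comp continuous_subtype_val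

theorem continuous_of_mem_sphericalHarmonics {k : ℕ} {f : UnitSphere d → ℝ}
    (hf : f ∈ sphericalHarmonics d k) : Continuous f := by
  obtain ⟨q, -, rfl⟩ := hf
  exact continuous_restrictToSphere q

/-- The Funk–Hecke formula for monomials. -/
theorem integral_inner_pow_mul (hd : 0 < d) (n : ℕ) {k : ℕ} {f : UnitSphere d → ℝ}
    (hf : f ∈ sphericalHarmonics d k) (x : UnitSphere d) :
    ∫ z : UnitSphere d, inner ℝ (x : EuclideanSpace ℝ (Fin d)) z ^ n * f z ∂(sphereUniform d) =
      powEigenvalue d n k * f x := by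
  obtain ⟨q, ⟨hq, hq0⟩, rfl⟩ := hf
  set a : Fin d → ℝ := fun i => (x : EuclideanSpace ℝ (Fin d)) i
  have ha : ∑ i, a i ^ 2 = 1 := by
    simpa [polyNormSq] using eval_polyNormSq x
  have hhom : (linForm a ^ n * q).IsHomogeneous (n + k) := by
    simpa using ((isHomogeneous_linForm a).pow n).mul hq
  have h := integral_restrictToSphere hd hhom
  rw [polyGaussIntegral_linForm_pow_mul a ha n hq hq0,
    mul_div_cancel_right₀ _ (polyGaussIntegral_one_pos hd).ne'] at h
  simp only [restrictToSphere_mul, a, restrictToSphere_linForm_pow] at h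
  rw [h, powEigenvalue]
  simp [restrictToSphere]
  ring

theorem integral_mul_eq_zero_of_ne (hd : 0 < d) {k l : ℕ} (hkl : k ≠ l) {f g : UnitSphere d → ℝ}
    (hf : f ∈ sphericalHarmonics d k) (hg : g ∈ sphericalHarmonics d l) :
    ∫ x, f x * g x ∂(sphereUniform d) = 0 := by
  obtain ⟨p, ⟨hp, hp0⟩, rfl⟩ := hf
  obtain ⟨q, ⟨hq, hq0⟩, rfl⟩ := hg
  simp only [← restrictToSphere_mul]
  rw [integral_restrictToSphere hd (hp.mul hq), polyGaussIntegral_mul_eq_zero hp hq hp0 hq0 hkl]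
  simp

/-- Both sides satisfy the same two-step recurrence, by `Γ(s + 1) = s Γ(s)`; the parity factor kills
the odd moments. -/
theorem normalMoment_mul_rpow (l : ℕ) :
    normalMoment l = 2 ^ ((l : ℝ) / 2) *
      ((1 + (-1 : ℝ) ^ l) / 2 * (Real.Gamma (((l : ℝ) + 1) / 2) / Real.sqrt Real.pi)) := by
  induction l using Nat.twoStepInduction with
  | zero =>
    have : Real.sqrt Real.pi ≠ 0 := by positivity
    simp [normalMoment, Real.Gamma_one_half_eq, -one_div, div_self this]
  | one => simp [normalMoment]
  | more l ih _ =>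
    rw [normalMoment, ih]
    have h1 : (((l + 2 : ℕ) : ℝ) + 1) / 2 = ((l : ℝ) + 1) / 2 + 1 := by push_cast; ring
    have h2 : ((l + 2 : ℕ) : ℝ) / 2 = (l : ℝ) / 2 + 1 := by push_cast; ring
    rw [h1, h2, Real.Gamma_add_one (by positivity), Real.rpow_add_one (by norm_num), pow_add]
    ring

theorem sphereArea_eq (hd : 0 < d) :
    sphereArea d = 2 * Real.sqrt Real.pi ^ d / Real.Gamma ((d : ℝ) / 2) := by
  have : Nonempty (Fin d) := ⟨⟨0, hd⟩⟩
  have hd' : (d : ℝ) / 2 ≠ 0 := by positivity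
  have hG : 0 < Real.Gamma ((d : ℝ) / 2) := Real.Gamma_pos_of_pos (by positivity)
  rw [sphereArea, surfaceMeasure, Measure.toSphere_real_apply_univ, measureReal_def,
    EuclideanSpace.volume_ball]
  simp only [finrank_euclideanSpace, Fintype.card_fin, ENNReal.ofReal_one, one_pow, one_mul]
  rw [Real.Gamma_add_one hd', ENNReal.toReal_ofReal (by positivity)]
  have : (d : ℝ) ≠ 0 := by positivity
  field_simp

theorem sphereArea_ratio (hd : 2 ≤ d) :
    sphereArea (d - 1) / sphereArea d * Real.Gamma (((d : ℝ) - 1) / 2) =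
      Real.Gamma ((d : ℝ) / 2) / Real.sqrt Real.pi := by
  obtain ⟨e, rfl⟩ : ∃ e, d = e + 1 := ⟨d - 1, by omega⟩
  have he : 0 < e := by omega
  rw [sphereArea_eq (Nat.succ_pos e), Nat.add_sub_cancel, sphereArea_eq he]
  have h1 : 0 < Real.Gamma ((e : ℝ) / 2) := Real.Gamma_pos_of_pos (by positivity)
  have h2 : 0 < Real.Gamma (((e + 1 : ℕ) : ℝ) / 2) := Real.Gamma_pos_of_pos (by positivity)
  have h3 : (((e + 1 : ℕ) : ℝ) - 1) / 2 = (e : ℝ) / 2 := by push_cast; ring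
  have h4 : 0 < Real.sqrt Real.pi := by positivity
  rw [h3, pow_succ]
  field_simp

theorem powEigenvalue_add (hd : 2 ≤ d) (k l : ℕ) :
    powEigenvalue d (k + l) k =
      sphereArea (d - 1) / sphereArea d * Real.Gamma (((d : ℝ) - 1) / 2) *
        (((k + l).factorial : ℝ) / (l.factorial : ℝ) * ((1 + (-1 : ℝ) ^ l) / 2 ^ (k + 1)) *
        (Real.Gamma (((l : ℝ) + 1) / 2) / Real.Gamma ((k : ℝ) + ((l : ℝ) + (d : ℝ)) / 2))) := by
  rw [sphereArea_ratio hd, powEigenvalue, hermiteMoment_add, normalMoment_mul_rpow, gaussRadial,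
    gaussRadial]
  have h1 : ((d : ℝ) + (k + l + k : ℕ)) / 2 = (k : ℝ) + ((l : ℝ) + d) / 2 := by push_cast; ring
  -- `2 ^ (d / 2)` cancels against `gaussRadial d 0` and `2 ^ (l / 2)` against the normal moment,
  -- leaving `2 ^ k`; the parity factor adds the last 2.
  have h2 : (2 : ℝ) ^ ((k : ℝ) + ((l : ℝ) + d) / 2) =
      2 ^ k * 2 ^ ((l : ℝ) / 2) * 2 ^ ((d : ℝ) / 2) := by
    rw [← Real.rpow_natCast, ← Real.rpow_add (by norm_num), ← Real.rpow_add (by norm_num)]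
    congr 1
    ring
  have h3 : 0 < Real.Gamma ((k : ℝ) + ((l : ℝ) + d) / 2) :=
    Real.Gamma_pos_of_pos (by positivity)
  have h4 : (0 : ℝ) < 2 ^ ((l : ℝ) / 2) := by positivity
  have h5 : (0 : ℝ) < 2 ^ ((d : ℝ) / 2) := by positivity
  have h6 : 0 < Real.sqrt Real.pi := by positivity
  rw [h1, h2, Nat.cast_zero, add_zero, pow_succ]
  field_simp

end Sphere

/-! ### Expansions in spherical harmonics -/

section Expansion

open MvPolynomial

variable {d : ℕ}

theorem Continuous.integrable_sphereUniform (hd : 0 < d) {f : UnitSphere d → ℝ}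
    (hf : Continuous f) : Integrable f (sphereUniform d) := by
  have := isProbabilityMeasure_sphereUniform hd
  exact hf.integrable_of_hasCompactSupport (HasCompactSupport.of_compactSpace f)

theorem abs_inner_sphere_le_one (x z : UnitSphere d) :
    |inner ℝ (x : EuclideanSpace ℝ (Fin d)) z| ≤ 1 := by
  have h := abs_real_inner_le_norm (x : EuclideanSpace ℝ (Fin d)) z
  have hx : ‖(x : EuclideanSpace ℝ (Fin d))‖ = 1 := by simp
  have hz : ‖(z : EuclideanSpace ℝ (Fin d))‖ = 1 := by simp
  simpa [hx, hz] using h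

theorem inner_sphere_self (x : UnitSphere d) :
    inner ℝ (x : EuclideanSpace ℝ (Fin d)) x = 1 := by
  have hx : ‖(x : EuclideanSpace ℝ (Fin d))‖ = 1 := by simp
  rw [real_inner_self_eq_norm_sq, hx, one_pow]

/-- Funk–Hecke for a harmonic `A` at a point where `A = 1` bounds the eigenvalue by `sup |A|`,
because `|⟨x, z⟩ⁿ| ≤ 1`. -/
theorem exists_powEigenvalue_le (hd : 2 ≤ d) (k : ℕ) : ∃ c, ∀ n, powEigenvalue d n k ≤ c := by
  obtain ⟨A, hA, hA0, x, hx⟩ := exists_harmonic_eval_eq_one hd k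
  have hd0 : 0 < d := by omega
  have := isProbabilityMeasure_sphereUniform hd0
  have hmem : restrictToSphere d A ∈ sphericalHarmonics d k := ⟨A, ⟨hA, hA0⟩, rfl⟩
  obtain ⟨c, hc⟩ := isCompact_univ.exists_bound_of_continuousOn
    (continuous_restrictToSphere A).continuousOn
  refine ⟨c, fun n => ?_⟩
  have h := integral_inner_pow_mul hd0 n hmem x
  rw [show restrictToSphere d A x = 1 from hx, mul_one] at h
  rw [← h]
  refine (le_abs_self _).trans ?_
  have hb : ∀ z : UnitSphere d,
      ‖inner ℝ (x : EuclideanSpace ℝ (Fin d)) z ^ n * restrictToSphere d A z‖ ≤ c := fun z => by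
    rw [norm_mul, norm_pow]
    exact (mul_le_of_le_one_left (norm_nonneg _)
      (pow_le_one₀ (norm_nonneg _) (abs_inner_sphere_le_one x z))).trans (hc z (Set.mem_univ z))
  simpa using norm_integral_le_of_norm_le_const (μ := sphereUniform d) (ae_of_all _ hb)

variable {Y : (k : ℕ) → Fin (harmonicDim d k) → UnitSphere d → ℝ}

theorem IsHarmonicONB.mem {k : ℕ} {y : Fin (harmonicDim d k) → UnitSphere d → ℝ}
    (hy : IsHarmonicONB d k y) (j : Fin (harmonicDim d k)) : y j ∈ sphericalHarmonics d k :=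
  hy.span_eq ▸ Submodule.subset_span ⟨j, rfl⟩

theorem IsHarmonicONB.continuous {k : ℕ} {y : Fin (harmonicDim d k) → UnitSphere d → ℝ}
    (hy : IsHarmonicONB d k y) (j : Fin (harmonicDim d k)) : Continuous (y j) :=
  continuous_of_mem_sphericalHarmonics (hy.mem j)

theorem eq_sum_integral_mul (hd : 0 < d) (hY : ∀ k, IsHarmonicONB d k (Y k)) (n : ℕ)
    {f : UnitSphere d → ℝ} (hf : f ∈ ⨆ k : Finset.range (n + 1), sphericalHarmonics d k)
    (x : UnitSphere d) :
    f x = ∑ k ∈ Finset.range (n + 1), ∑ j, (∫ z, f z * Y k j z ∂(sphereUniform d)) * Y k j x := by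
  have hint : ∀ {f : UnitSphere d → ℝ}, Continuous f → ∀ k j,
      Integrable (fun z => f z * Y k j z) (sphereUniform d) := fun hf k j =>
    (hf.mul ((hY k).continuous j)).integrable_sphereUniform hd
  -- The identity is linear in `f`, so it suffices to check it on the `Y k j`. Continuity is part of
  -- `S` so that the integrals are additive.
  let S : Submodule ℝ (UnitSphere d → ℝ) :=
    { carrier := {f | Continuous f ∧ ∀ x, f x = ∑ k ∈ Finset.range (n + 1),
        ∑ j, (∫ z, f z * Y k j z ∂(sphereUniform d)) * Y k j x}
      zero_mem' := ⟨continuous_const, by simp⟩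
      add_mem' := fun {f g} hf hg => ⟨hf.1.add hg.1, fun x => by
        simp only [Pi.add_apply, add_mul, integral_add (hint hf.1 _ _) (hint hg.1 _ _),
          Finset.sum_add_distrib, ← hf.2 x, ← hg.2 x]⟩
      smul_mem' := fun c f hf => ⟨hf.1.const_smul c, fun x => by
        simp only [Pi.smul_apply, smul_eq_mul, mul_assoc, integral_const_mul, ← Finset.mul_sum,
          ← hf.2 x]⟩ }
  have hS : ⨆ k : Finset.range (n + 1), sphericalHarmonics d k ≤ S := by
    refine iSup_le fun ⟨k, hk⟩ => ?_
    rw [← (hY k).span_eq, Submodule.span_le]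
    rintro _ ⟨j, rfl⟩
    refine ⟨(hY k).continuous j, fun x => ?_⟩
    rw [Finset.sum_eq_single k]
    · simp [(hY k).orthonormal]
    · intro l _ hl
      simp [integral_mul_eq_zero_of_ne hd hl.symm ((hY k).mem j) ((hY l).mem _)]
    · exact fun h => absurd hk h
  exact (hS hf).2 x

/-- The expansion of `⟨x, z⟩ⁿ` in spherical harmonics. -/
theorem inner_pow_eq_sum (hd : 0 < d) (hY : ∀ k, IsHarmonicONB d k (Y k)) (n : ℕ)
    (x z : UnitSphere d) :
    inner ℝ (x : EuclideanSpace ℝ (Fin d)) z ^ n =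
      ∑ k ∈ Finset.range (n + 1), powEigenvalue d n k * ∑ j, Y k j x * Y k j z := by
  set q := linForm (fun i => (x : EuclideanSpace ℝ (Fin d)) i) ^ n
  have hq : q.IsHomogeneous n := by simpa using (isHomogeneous_linForm _).pow n
  have h := eq_sum_integral_mul hd hY n (restrictToSphere_mem_iSup hd hq) z
  simp only [q, restrictToSphere_linForm_pow] at h
  rw [h]
  refine Finset.sum_congr rfl fun k _ => ?_
  rw [Finset.mul_sum]
  refine Finset.sum_congr rfl fun j _ => ?_
  rw [integral_inner_pow_mul hd n ((hY k).mem j) x, mul_assoc]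

theorem hasSum_inner_pow (hd : 0 < d) (hY : ∀ k, IsHarmonicONB d k (Y k)) (n : ℕ)
    (x z : UnitSphere d) :
    HasSum (fun k => powEigenvalue d n k * ∑ j, Y k j x * Y k j z)
      (inner ℝ (x : EuclideanSpace ℝ (Fin d)) z ^ n) := by
  rw [inner_pow_eq_sum hd hY n x z]
  refine hasSum_sum_of_ne_finset_zero fun k hk => ?_
  rw [powEigenvalue_of_lt (by simpa [Nat.lt_succ_iff] using hk), zero_mul]

/-- Bounds the off-diagonal terms of a zonal expansion by the diagonal ones at `x` and `z`. -/
theorem abs_sum_mul_le {ι : Type*} (s : Finset ι) (f g : ι → ℝ) :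
    |∑ j ∈ s, f j * g j| ≤ (∑ j ∈ s, f j * f j + ∑ j ∈ s, g j * g j) / 2 := by
  refine (Finset.abs_sum_le_sum_abs _ _).trans ?_
  rw [← Finset.sum_add_distrib, Finset.sum_div]
  refine Finset.sum_le_sum fun j _ => abs_le.2 ⟨?_, ?_⟩
  · nlinarith [sq_nonneg (f j + g j)]
  · nlinarith [sq_nonneg (f j - g j)]

theorem memLp_harmonic (hd : 0 < d) {k : ℕ} {y : Fin (harmonicDim d k) → UnitSphere d → ℝ}
    (hy : IsHarmonicONB d k y) (j : Fin (harmonicDim d k)) : MemLp (y j) 2 (sphereUniform d) := by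
  have := isProbabilityMeasure_sphereUniform hd
  exact (hy.continuous j).memLp_of_hasCompactSupport (HasCompactSupport.of_compactSpace _)

/-- Restrictions of polynomials to the sphere, as an algebra of continuous functions. -/
def spherePolynomials (d : ℕ) : Subalgebra ℝ C(UnitSphere d, ℝ) :=
  (aeval fun i : Fin d => (⟨fun x => (x : EuclideanSpace ℝ (Fin d)) i,
    (EuclideanSpace.proj i).continuous.comp continuous_subtype_val⟩ : C(UnitSphere d, ℝ))).range

theorem aeval_coord_apply (q : MvPolynomial (Fin d) ℝ) (x : UnitSphere d) :
    (aeval fun i : Fin d => (⟨fun x => (x : EuclideanSpace ℝ (Fin d)) i,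
      (EuclideanSpace.proj i).continuous.comp continuous_subtype_val⟩ : C(UnitSphere d, ℝ))) q x =
      restrictToSphere d q x := by
  induction q using MvPolynomial.induction_on with
  | C a => simp [restrictToSphere]
  | add p q hp hq => simp [hp, hq]
  | mul_X p i hp =>
    rw [map_mul, ContinuousMap.mul_apply, hp, restrictToSphere_mul, aeval_X]
    congr 1
    simp [restrictToSphere]
    rfl

/-- Stone–Weierstrass: the coordinates separate points. -/
theorem dense_spherePolynomials : Dense (spherePolynomials d : Set C(UnitSphere d, ℝ)) := by
  have h := ContinuousMap.subalgebra_topologicalClosure_eq_top_of_separatesPoints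
    (spherePolynomials d) ?_
  · rw [dense_iff_closure_eq, ← Subalgebra.topologicalClosure_coe, h]
    rfl
  · intro x z hxz
    obtain ⟨i, hi⟩ : ∃ i, (x : EuclideanSpace ℝ (Fin d)) i ≠ (z : EuclideanSpace ℝ (Fin d)) i := by
      by_contra! h
      exact hxz (Subtype.ext (PiLp.ext h))
    refine ⟨_, ⟨_, ⟨X i, rfl⟩, rfl⟩, ?_⟩
    simp only [AlgHom.toRingHom_eq_coe, RingHom.coe_coe, aeval_X]
    exact hi

/-- Spherical harmonics form a Hilbert basis of `L²` of the sphere. -/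
theorem exists_hilbertBasis_sphericalHarmonics (hd : 0 < d) (hY : ∀ k, IsHarmonicONB d k (Y k)) :
    ∃ b : HilbertBasis ((k : ℕ) × Fin (harmonicDim d k)) ℝ (Lp ℝ 2 (sphereUniform d)),
      ∀ i, b i =ᵐ[sphereUniform d] Y i.1 i.2 := by
  have := isProbabilityMeasure_sphereUniform hd
  let v : ((k : ℕ) × Fin (harmonicDim d k)) → Lp ℝ 2 (sphereUniform d) := fun i =>
    (memLp_harmonic hd (hY i.1) i.2).toLp
  have hv : ∀ i, v i =ᵐ[sphereUniform d] Y i.1 i.2 := fun i => MemLp.coeFn_toLp _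
  have hort : Orthonormal ℝ v := by
    rw [orthonormal_iff_ite]
    rintro ⟨k, i⟩ ⟨l, j⟩
    have h : inner ℝ (v ⟨k, i⟩) (v ⟨l, j⟩) = ∫ x, Y k i x * Y l j x ∂(sphereUniform d) := by
      rw [L2.inner_def]
      refine integral_congr_ae ?_
      filter_upwards [hv ⟨k, i⟩, hv ⟨l, j⟩] with x h1 h2
      rw [h1, h2]
      simp [mul_comm]
    rw [h]
    rcases eq_or_ne k l with rfl | hkl
    · simp [(hY k).orthonormal]
    · rw [integral_mul_eq_zero_of_ne hd hkl ((hY k).mem i) ((hY l).mem j), if_neg]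
      exact fun h => hkl (congrArg Sigma.fst h)
  have hdense : Dense (Submodule.span ℝ (Set.range v) : Set (Lp ℝ 2 (sphereUniform d))) := by
    refine ((ContinuousMap.toLp_denseRange ℝ (sphereUniform d) ℝ
      (p := 2) (by norm_num)).dense_image (ContinuousLinearMap.continuous _)
      dense_spherePolynomials).mono ?_
    rintro _ ⟨f, ⟨q, rfl⟩, rfl⟩
    -- The finite harmonic expansion is available for homogeneous polynomials only.
    rw [← sum_homogeneousComponent q]
    simp only [RingHom.coe_coe, map_sum, SetLike.mem_coe, AlgHom.toRingHom_eq_coe]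
    refine Submodule.sum_mem _ fun n _ => ?_
    set r := homogeneousComponent n q
    have hr : r.IsHomogeneous n := homogeneousComponent_isHomogeneous n q
    have hexp := eq_sum_integral_mul hd hY n (restrictToSphere_mem_iSup hd hr)
    have hmem : ∑ k ∈ Finset.range (n + 1), ∑ j,
        (∫ z, restrictToSphere d r z * Y k j z ∂(sphereUniform d)) • v ⟨k, j⟩ ∈
        Submodule.span ℝ (Set.range v) :=
      Submodule.sum_mem _ fun k _ => Submodule.sum_mem _ fun j _ =>
        Submodule.smul_mem _ _ (Submodule.subset_span ⟨_, rfl⟩)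
    convert hmem using 1
    have hYc : ∀ k j, v ⟨k, j⟩ = ContinuousMap.toLp 2 (sphereUniform d) ℝ
        (⟨Y k j, (hY k).continuous j⟩ : C(UnitSphere d, ℝ)) := fun k j => rfl
    simp only [hYc, ← map_smul, ← map_sum]
    congr 1
    ext x
    rw [aeval_coord_apply, hexp x]
    simp [ContinuousMap.sum_apply]
  refine ⟨HilbertBasis.mk hort ?_, fun i => ?_⟩
  · rw [top_le_iff]
    exact Submodule.dense_iff_topologicalClosure_eq_top.1 hdense
  · rw [HilbertBasis.coe_mk]
    exact hv i

end Expansion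

/-! ### Zonal kernels with a nonnegative power series -/

section ZonalKernel

variable {d : ℕ} {p : ℕ → ℝ} {K : ℝ → ℝ}

/-- Weierstrass M-test with majorant `p n`. -/
theorem continuous_zonal (hp : Summable p) (hp0 : ∀ n, 0 ≤ p n)
    (hK : ∀ s, |s| ≤ 1 → HasSum (fun n => p n * s ^ n) (K s)) :
    Continuous fun q : UnitSphere d × UnitSphere d =>
      K (inner ℝ (q.1 : EuclideanSpace ℝ (Fin d)) q.2) := by
  have h : (fun q : UnitSphere d × UnitSphere d =>
      K (inner ℝ (q.1 : EuclideanSpace ℝ (Fin d)) q.2)) = fun q =>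
      ∑' n, p n * inner ℝ (q.1 : EuclideanSpace ℝ (Fin d)) q.2 ^ n :=
    funext fun q => (hK _ (abs_inner_sphere_le_one q.1 q.2)).tsum_eq.symm
  rw [h]
  refine continuous_tsum (u := p) (fun n => ?_) hp fun n q => ?_
  · fun_prop
  · rw [norm_mul, norm_pow, Real.norm_of_nonneg (hp0 n)]
    exact mul_le_of_le_one_right (hp0 n)
      (pow_le_one₀ (norm_nonneg _) (abs_inner_sphere_le_one q.1 q.2))

theorem summable_mul_powEigenvalue (hd : 2 ≤ d) (hp : Summable p) (hp0 : ∀ n, 0 ≤ p n) (k : ℕ) :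
    Summable fun n => p n * powEigenvalue d n k := by
  obtain ⟨c, hc⟩ := exists_powEigenvalue_le hd k
  exact Summable.of_nonneg_of_le
    (fun n => mul_nonneg (hp0 n) (powEigenvalue_nonneg (by omega) n k))
    (fun n => mul_le_mul_of_nonneg_left (hc n) (hp0 n)) (hp.mul_right c)

theorem hasSum_zonal (hd : 2 ≤ d) (hp : Summable p) (hp0 : ∀ n, 0 ≤ p n)
    (hK : ∀ s, |s| ≤ 1 → HasSum (fun n => p n * s ^ n) (K s))
    {Y : (k : ℕ) → Fin (harmonicDim d k) → UnitSphere d → ℝ}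
    (hY : ∀ k, IsHarmonicONB d k (Y k)) (x z : UnitSphere d) :
    HasSum (fun k => (∑' n, p n * powEigenvalue d n k) * ∑ j, Y k j x * Y k j z)
      (K (inner ℝ (x : EuclideanSpace ℝ (Fin d)) z)) := by
  have hd0 : 0 < d := by omega
  -- For `x = z` every term is nonnegative and the sum over `k` is `p n * ⟨x, x⟩ⁿ = p n`, so the
  -- double family is summable.
  have hdiag : ∀ x : UnitSphere d, Summable fun q : ℕ × ℕ =>
      p q.1 * (powEigenvalue d q.1 q.2 * ∑ j, Y q.2 j x * Y q.2 j x) := fun x => by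
    have hn : ∀ n, HasSum (fun k => p n * (powEigenvalue d n k * ∑ j, Y k j x * Y k j x)) (p n) :=
      fun n => by
        simpa [inner_sphere_self] using (hasSum_inner_pow hd0 hY n x x).mul_left (p n)
    rw [summable_prod_of_nonneg]
    · refine ⟨fun n => (hn n).summable, ?_⟩
      simpa only [fun n => (hn n).tsum_eq] using hp
    · exact fun q => mul_nonneg (hp0 _) (mul_nonneg (powEigenvalue_nonneg hd0 _ _)
        (Finset.sum_nonneg fun j _ => mul_self_nonneg _))
  have hsum : Summable fun q : ℕ × ℕ =>
      p q.1 * (powEigenvalue d q.1 q.2 * ∑ j, Y q.2 j x * Y q.2 j z) := by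
    refine Summable.of_norm_bounded (((hdiag x).add (hdiag z)).div_const 2) fun q => ?_
    rw [norm_mul, norm_mul, Real.norm_of_nonneg (hp0 _),
      Real.norm_of_nonneg (powEigenvalue_nonneg hd0 _ _), ← mul_add, ← mul_add, mul_div_assoc,
      mul_div_assoc]
    exact mul_le_mul_of_nonneg_left (mul_le_mul_of_nonneg_left (abs_sum_mul_le _ _ _)
      (powEigenvalue_nonneg hd0 _ _)) (hp0 _)
  -- Summing over `k` first gives the kernel; summing the same family over `n` first gives the
  -- eigenvalue expansion.
  have h1 := hsum.hasSum.prod_fiberwise fun n => (hasSum_inner_pow hd0 hY n x z).mul_left (p n)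
  have hval := h1.unique (hK _ (abs_inner_sphere_le_one x z))
  rw [← hval]
  have hswap := (Equiv.prodComm ℕ ℕ).hasSum_iff.2 hsum.hasSum
  refine hswap.prod_fiberwise fun k => ?_
  have := (summable_mul_powEigenvalue hd hp hp0 k).hasSum.mul_right (∑ j, Y k j x * Y k j z)
  simpa [mul_assoc] using this

theorem integrable_zonal_mul (hd : 0 < d) (hp : Summable p) (hp0 : ∀ n, 0 ≤ p n)
    (hK : ∀ s, |s| ≤ 1 → HasSum (fun n => p n * s ^ n) (K s)) {f : UnitSphere d → ℝ}
    (hf : MemLp f 2 (sphereUniform d)) (x : UnitSphere d) :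
    Integrable (fun z : UnitSphere d => K (inner ℝ (x : EuclideanSpace ℝ (Fin d)) z) * f z)
      (sphereUniform d) := by
  have := isProbabilityMeasure_sphereUniform hd
  have hc : Continuous fun z : UnitSphere d => K (inner ℝ (x : EuclideanSpace ℝ (Fin d)) z) :=
    (continuous_zonal hp hp0 hK).comp (Continuous.prodMk_right x)
  obtain ⟨c, hb⟩ := isCompact_univ.exists_bound_of_continuousOn hc.continuousOn
  exact (hf.integrable (by norm_num)).bdd_mul hc.aestronglyMeasurable
    (ae_of_all _ fun z => hb z (Set.mem_univ z))

theorem memLp_integral_zonal_mul (hd : 0 < d) (hp : Summable p) (hp0 : ∀ n, 0 ≤ p n)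
    (hK : ∀ s, |s| ≤ 1 → HasSum (fun n => p n * s ^ n) (K s)) {f : UnitSphere d → ℝ}
    (hf : MemLp f 2 (sphereUniform d)) :
    MemLp (fun x : UnitSphere d => ∫ z : UnitSphere d,
      K (inner ℝ (x : EuclideanSpace ℝ (Fin d)) z) * f z ∂(sphereUniform d)) 2
      (sphereUniform d) := by
  have := isProbabilityMeasure_sphereUniform hd
  have hc := continuous_zonal (d := d) hp hp0 hK
  obtain ⟨c, hb⟩ := isCompact_univ.exists_bound_of_continuousOn hc.continuousOn
  refine Continuous.memLp_of_hasCompactSupport ?_ (HasCompactSupport.of_compactSpace _)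
  refine continuous_of_dominated (bound := fun z => c * ‖f z‖)
    (fun x => (integrable_zonal_mul hd hp hp0 hK hf x).aestronglyMeasurable)
    (fun x => ae_of_all _ fun z => ?_) ((hf.integrable (by norm_num)).norm.const_mul c)
    (ae_of_all _ fun z => (hc.comp (Continuous.prodMk_left z)).mul continuous_const)
  rw [norm_mul]
  exact mul_le_mul_of_nonneg_right (hb (x, z) (Set.mem_univ _)) (norm_nonneg _)

/-- The power series is integrated term by term, dominated by `p n * sup |f|`, and Funk–Hecke
applies to each term. -/
theorem integral_zonal_mul_harmonic (hd : 0 < d) (hp : Summable p) (hp0 : ∀ n, 0 ≤ p n)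
    (hK : ∀ s, |s| ≤ 1 → HasSum (fun n => p n * s ^ n) (K s)) {k : ℕ} {f : UnitSphere d → ℝ}
    (hf : f ∈ sphericalHarmonics d k) (x : UnitSphere d) :
    ∫ z : UnitSphere d, K (inner ℝ (x : EuclideanSpace ℝ (Fin d)) z) * f z ∂(sphereUniform d) =
      (∑' n, p n * powEigenvalue d n k) * f x := by
  have := isProbabilityMeasure_sphereUniform hd
  have hfc := continuous_of_mem_sphericalHarmonics hf
  obtain ⟨c, hb⟩ := isCompact_univ.exists_bound_of_continuousOn hfc.continuousOn
  have hcont : ∀ n, Continuous fun z : UnitSphere d =>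
      p n * (inner ℝ (x : EuclideanSpace ℝ (Fin d)) z ^ n * f z) := fun n => by fun_prop
  have hbound : ∀ n (z : UnitSphere d), ‖p n * (inner ℝ (x : EuclideanSpace ℝ (Fin d)) z ^ n * f z)‖ ≤ p n * c :=
    fun n z => by
      rw [norm_mul, norm_mul, norm_pow, Real.norm_of_nonneg (hp0 n)]
      exact mul_le_mul_of_nonneg_left ((mul_le_of_le_one_left (norm_nonneg _)
        (pow_le_one₀ (norm_nonneg _) (abs_inner_sphere_le_one x z))).trans
        (hb z (Set.mem_univ z))) (hp0 n)
  have h := hasSum_integral_of_dominated_convergence (μ := sphereUniform d)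
    (bound := fun n _ => p n * c) (F := fun n (z : UnitSphere d) =>
      p n * (inner ℝ (x : EuclideanSpace ℝ (Fin d)) z ^ n * f z))
    (f := fun z => K (inner ℝ (x : EuclideanSpace ℝ (Fin d)) z) * f z)
    (fun n => (hcont n).aestronglyMeasurable) (fun n => ae_of_all _ (hbound n))
    (ae_of_all _ fun _ => hp.mul_right c) (integrable_const _)
    (ae_of_all _ fun z => by
      simpa [mul_assoc] using (hK _ (abs_inner_sphere_le_one x z)).mul_right (f z))
  simp only [integral_const_mul, integral_inner_pow_mul hd _ hf x] at h
  simp only [← mul_assoc] at h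
  rw [← h.tsum_eq, tsum_mul_right]

end ZonalKernel

end

/-! ### The spectral decomposition of the compositional kernel -/

theorem theorem4
    (d : ℕ) (hd : 2 ≤ d)
    (σ : ℝ → ℝ) (hσ : IsNormalizedActivation σ)
    {Ω : Type*} [MeasurableSpace Ω] (P : Measure Ω) [IsProbabilityMeasure P]
    (Z : ℕ → Ω → ℕ) (hZ : IsGaltonWatson P (fun k => hermiteCoeff σ k ^ 2) Z)
    (Y : (k : ℕ) → Fin (harmonicDim d k) → UnitSphere d → ℝ)
    (hY : ∀ k, IsHarmonicONB d k (Y k))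
    (L : ℕ) :
    ∃ lam : ℕ → ℝ,
      -- the explicit formula for the eigenvalues, with a convergent series
      (∀ k : ℕ, ∃ s : ℝ,
        HasSum (fun ℓ : ℕ => P.real {ω | Z L ω = k + ℓ}
          * (((k + ℓ).factorial : ℝ) / (ℓ.factorial : ℝ))
          * ((1 + (-1 : ℝ) ^ ℓ) / 2 ^ (k + 1))
          * (Real.Gamma (((ℓ : ℝ) + 1) / 2) / Real.Gamma ((k : ℝ) + ((ℓ : ℝ) + (d : ℝ)) / 2))) s ∧
        lam k = sphereArea (d - 1) / sphereArea d * Real.Gamma (((d : ℝ) - 1) / 2) * s) ∧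
      -- the spectral decomposition, at every pair of points of the sphere
      (∀ x z : UnitSphere d,
        HasSum (fun k : ℕ => lam k * ∑ j, Y k j x * Y k j z)
          (compKernel σ L (inner ℝ (x : EuclideanSpace ℝ (Fin d)) z))) ∧
      -- the functions `Y k j` form an orthonormal basis of `L²` of the sphere
      (∃ b : HilbertBasis ((k : ℕ) × Fin (harmonicDim d k)) ℝ (Lp ℝ 2 (sphereUniform d)),
        ∀ i, b i =ᵐ[sphereUniform d] Y i.1 i.2) ∧
      -- the integral operator is well defined on `L²`, and `Y k j` is an eigenfunction
      -- with eigenvalue `lam k`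
      (∀ f : UnitSphere d → ℝ, MemLp f 2 (sphereUniform d) →
        (∀ x : UnitSphere d, Integrable (fun z : UnitSphere d =>
          compKernel σ L (inner ℝ (x : EuclideanSpace ℝ (Fin d)) z) * f z) (sphereUniform d)) ∧
        MemLp (kernelOperator d σ L f) 2 (sphereUniform d)) ∧
      (∀ k j x, kernelOperator d σ L (Y k j) x = lam k * Y k j x) := by
  have hd0 : 0 < d := by omega
  set p : ℕ → ℝ := fun n => P.real {ω | Z L ω = n} with hpdef
  have hp0 : ∀ n, 0 ≤ p n := fun n => measureReal_nonneg
  have hK : ∀ s, |s| ≤ 1 → HasSum (fun n => p n * s ^ n) (compKernel σ L s) := fun s hs =>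
    IsGaltonWatson.hasSum_iterate hZ L hs
  have hp : Summable p := by simpa using (hK 1 (by simp)).summable
  refine ⟨fun k => ∑' n, p n * powEigenvalue d n k, fun k => ?_,
    hasSum_zonal hd hp hp0 hK hY, exists_hilbertBasis_sphericalHarmonics hd0 hY,
    fun f hf => ⟨integrable_zonal_mul hd0 hp hp0 hK hf, memLp_integral_zonal_mul hd0 hp hp0 hK hf⟩,
    fun k j x => integral_zonal_mul_harmonic hd0 hp hp0 hK ((hY k).mem j) x⟩
  set A := sphereArea (d - 1) / sphereArea d * Real.Gamma (((d : ℝ) - 1) / 2) with hA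
  have hA0 : A ≠ 0 := by
    have : 0 < Real.Gamma ((d : ℝ) / 2) := Real.Gamma_pos_of_pos (by positivity)
    rw [hA, sphereArea_ratio hd]
    positivity
  -- Powers `n < k` are orthogonal to harmonics of degree `k`, so the sum starts at `n = k`.
  have hshift : HasSum (fun l => p (k + l) * powEigenvalue d (k + l) k)
      (∑' n, p n * powEigenvalue d n k) := by
    refine ((add_right_injective k).hasSum_iff (f := fun n => p n * powEigenvalue d n k)
      fun n hn => ?_).2 (summable_mul_powEigenvalue hd hp hp0 k).hasSum
    have : n < k := by
      by_contra! h
      exact hn ⟨n - k, by simp; omega⟩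
    rw [powEigenvalue_of_lt this, mul_zero]
  -- The stated series omits the prefactor `A`, so its sum is the eigenvalue divided by `A`.
  refine ⟨A⁻¹ * ∑' n, p n * powEigenvalue d n k, ?_, (mul_inv_cancel_left₀ hA0 _).symm⟩
  have h := hshift.mul_left A⁻¹
  refine (congrArg (fun F => HasSum F _) (funext fun l => ?_)).mp h
  rw [powEigenvalue_add hd, ← hA, mul_left_comm (p _) A, inv_mul_cancel_left₀ hA0]
  simp only [hpdef]
  ring
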